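/- Let $d\ge 1$, let $\Gamma\subseteq\mathbb Z^d$ be a sublattice (subgroup) and let $(v(\mathbf m))_{\mathbf m\in\Gamma}$ be independent, identically distributed real random variables whose common law $\mu$ satisfies, for some $\alpha,q>0$: $\mu[t-\epsilon,t+\epsilon]\le C_{A1}\epsilon^\alpha$ for all $t\in\mathbb R$, $\epsilon>0$, and $\int|x|^q\,d\mu(x)\le C_{A2}$. Let $a:\mathbb Z^d\to\mathbb R$ (of arbitrary signs) have finite support of cardinality $k=\#\{\mathbf m: a_{\mathbf m}\ne0\}$, with $|a_{\mathbf m}|,|a_{\mathbf m}|^{-1}\le C_a$ on the support, and suppose that for every $\mathbf n\in\mathbb Z^d$ there is $\mathbf m\in\Gamma$ with $a_{\mathbf n-\mathbf m}\neq0$. Let $V(\mathbf n)=\sum_{\mathbf m\in\Gamma}a_{\mathbf n-\mathbf m}v(\mathbf m)$ and, for $g>0$, let $H$ be the random self-adjoint operator on $\ell^2(\mathbb Z^d)$ $$(H\psi)(\mathbf n)=V(\mathbf n)\psi(\mathbf n)+g^{-1}\sum_{\mathbf m\sim\mathbf n}K(\mathbf n,\mathbf m)\psi(\mathbf m)$$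 (sum over the $2d$ nearest neighbours), where the deterministic kernel $K$ satisfies $K(\mathbf m,\mathbf n)=\overline{K(\mathbf n,\mathbf m)}$ and $|K(\mathbf n,\mathbf m)|\le C_K$ for adjacent $\mathbf m,\mathbf n$ (for instance $K\equiv1$). Let $G_z=(H-z)^{-1}$ for $z\notin\mathbb R$, with matrix elements $G_z(\mathbf m,\mathbf n)$, let $\langle\cdot\rangle$ denote expectation, and let $\mathrm{dist}(\mathbf m,\mathbf n)=\|\mathbf m-\mathbf n\|_1$. Let $0<s<\frac{\alpha q}{2k\alpha+kq}$. There exists $C>0$, depending only on $\alpha,q,s,k,C_{A1},C_{A2},C_K,C_a$, such that for any $\lambda\in\mathbb R$, any $g\ge Cd^{1/s}/(1+|\lambda|)$ and any $\mathbf m,\mathbf n\in\mathbb Z^d$, the limit $G_{\lambda+i0}(\mathbf m,\mathbf n)=\lim_{\epsilon\to+0}G_{\lambda+i\epsilon}(\mathbf m,\mathbf n)$ exists (and is finite) almost surely, and $$\lim_{\epsilon\to+0}\langle|G_{\lambda+i\epsilon}(\mathbf m,\mathbf n)|^s\rangle=\langle|G_{\lambda+i0}(\mathbf m,\mathbf n)|^s\rangle\le\frac{C}{(1+|\lambda|)^s}\left(\frac{Cd}{g^s(1+|\lambda|)^s}\right)^{\mathrm{dist}(\mathbf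 m,\mathbf n)}.$$ -/

import Mathlib

open MeasureTheory ProbabilityTheory Filter Topology
open scoped ENNReal

namespace AlloyModel

/-- Sites of the lattice `ℤ^d`. -/
abbrev Site (d : ℕ) : Type := Fin d → ℤ

/-- The graph distance on `ℤ^d`, that is `‖m - n‖₁`. -/
def latticeDist {d : ℕ} (m n : Site d) : ℕ := ∑ i, (m i - n i).natAbs

/-- The unit vector in direction `i`. -/
def unitVec {d : ℕ} (i : Fin d) : Site d := Pi.single i 1

/-- The alloy-type potential `V(n) = ∑_{m ∈ Γ} a_{n-m} v(m)`. The sum has finitely many nonzero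
terms whenever `a` has finite support. -/
noncomputable def alloyPotential {d : ℕ} (Γ : AddSubgroup (Site d)) (a : Site d → ℝ)
    (v : Γ → ℝ) (n : Site d) : ℝ :=
  ∑ᶠ m : Γ, a (n - (m : Site d)) * v m

/-- The conditions on a hopping kernel: it is Hermitian and bounded by `c` on the (ordered) pairs
of adjacent sites. -/
def IsHopping {d : ℕ} (K : Site d → Site d → ℂ) (c : ℝ) : Prop :=
  ∀ m n : Site d, latticeDist m n = 1 → K n m = (starRingEnd ℂ) (K m n) ∧ ‖K m n‖ ≤ c

/-- The sum `∑_{y ∼ n} K(n,y) ψ(y)` over the `2d` nearest neighbours `y` of `n`. -/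
noncomputable def hop {d : ℕ} (K : Site d → Site d → ℂ) (ψ : Site d → ℂ) (n : Site d) : ℂ :=
  ∑ i : Fin d, (K n (n + unitVec i) * ψ (n + unitVec i) + K n (n - unitVec i) * ψ (n - unitVec i))

/-- The formal action `ψ ↦ V ψ + g⁻¹ ∑_{y ∼ ·} K(·,y) ψ(y)` on arbitrary functions. -/
noncomputable def formalH {d : ℕ} (V : Site d → ℝ) (K : Site d → Site d → ℂ) (g : ℝ)
    (ψ : Site d → ℂ) (n : Site d) : ℂ :=
  (V n : ℂ) * ψ n + ((g⁻¹ : ℝ) : ℂ) * hop K ψ n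

lemma hop_add {d : ℕ} (K : Site d → Site d → ℂ) (ψ φ : Site d → ℂ) :
    hop K (ψ + φ) = hop K ψ + hop K φ := by
  funext n
  simp only [hop, Pi.add_apply, ← Finset.sum_add_distrib]
  exact Finset.sum_congr rfl fun i _ => by ring

lemma hop_smul {d : ℕ} (K : Site d → Site d → ℂ) (c : ℂ) (ψ : Site d → ℂ) :
    hop K (c • ψ) = c • hop K ψ := by
  funext n
  simp only [hop, Pi.smul_apply, smul_eq_mul, Finset.mul_sum]
  exact Finset.sum_congr rfl fun i _ => by ring

lemma formalH_add {d : ℕ} (V : Site d → ℝ) (K : Site d → Site d → ℂ) (g : ℝ)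
    (ψ φ : Site d → ℂ) : formalH V K g (ψ + φ) = formalH V K g ψ + formalH V K g φ := by
  funext n
  simp only [formalH, hop_add, Pi.add_apply]
  ring

lemma formalH_smul {d : ℕ} (V : Site d → ℝ) (K : Site d → Site d → ℂ) (g : ℝ)
    (c : ℂ) (ψ : Site d → ℂ) : formalH V K g (c • ψ) = c • formalH V K g ψ := by
  funext n
  simp only [formalH, hop_smul, Pi.smul_apply, smul_eq_mul]
  ring

/-- The Hilbert space `ℓ²(ℤ^d)`. -/
abbrev Ell2 (d : ℕ) : Type := lp (fun _ : Site d => ℂ) 2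

/-- The operator `H` on `ℓ²(ℤ^d)`, with its natural domain: all `ψ ∈ ℓ²(ℤ^d)` for which the formal
expression `V ψ + g⁻¹ ∑ K ψ` is again in `ℓ²(ℤ^d)`. -/
noncomputable def hamiltonian {d : ℕ} (V : Site d → ℝ) (K : Site d → Site d → ℂ) (g : ℝ) :
    Ell2 d →ₗ.[ℂ] Ell2 d where
  domain :=
    { carrier := {ψ | Memℓp (formalH V K g (ψ : Site d → ℂ)) 2}
      zero_mem' := by
        have h := formalH_smul V K g 0 0
        rw [zero_smul, zero_smul] at h
        rw [Set.mem_ofPred_eq, lp.coeFn_zero, h]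
        exact zero_memℓp
      add_mem' := by
        intro ψ φ hψ hφ
        rw [Set.mem_ofPred_eq, lp.coeFn_add, formalH_add]
        exact Memℓp.add hψ hφ
      smul_mem' := by
        intro c ψ hψ
        rw [Set.mem_ofPred_eq, lp.coeFn_smul, formalH_smul]
        exact Memℓp.const_smul hψ c }
  toFun :=
    { toFun := fun ψ => ⟨formalH V K g ((ψ : Ell2 d) : Site d → ℂ), ψ.2⟩
      map_add' := by
        intro ψ φ
        apply lp.ext
        change formalH V K g (((ψ : Ell2 d) + (φ : Ell2 d) : Ell2 d) : Site d → ℂ) = _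
        rw [lp.coeFn_add, formalH_add]
        rfl
      map_smul' := by
        intro c ψ
        apply lp.ext
        change formalH V K g ((c • (ψ : Ell2 d) : Ell2 d) : Site d → ℂ) = _
        rw [lp.coeFn_smul, formalH_smul]
        rfl }

/-- `R` is the resolvent `(H - z)⁻¹` of the (possibly unbounded) operator `H` at `z`: a bounded
two-sided inverse of `H - z`. -/
def IsResolventAt {E : Type*} [NormedAddCommGroup E] [NormedSpace ℂ E] (H : E →ₗ.[ℂ] E) (z : ℂ)
    (R : E →L[ℂ] E) : Prop :=
  (∀ φ : E, ∃ h : R φ ∈ H.domain, H ⟨R φ, h⟩ - z • R φ = φ) ∧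
    ∀ ψ : H.domain, R (H ψ - z • (ψ : E)) = ψ

open Classical in
/-- The resolvent `(H - z)⁻¹`, for `z` in the resolvent set of `H` (and `0` elsewhere). -/
noncomputable def resolventOp {E : Type*} [NormedAddCommGroup E] [NormedSpace ℂ E]
    (H : E →ₗ.[ℂ] E) (z : ℂ) : E →L[ℂ] E :=
  if h : ∃ R : E →L[ℂ] E, IsResolventAt H z R then h.choose else 0

/-- The Green function `G_z(m,n)`, i.e. the matrix element `⟨δ_m, (H - z)⁻¹ δ_n⟩`. -/
noncomputable def green {d : ℕ} (V : Site d → ℝ) (K : Site d → Site d → ℂ) (g : ℝ) (z : ℂ)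
    (m n : Site d) : ℂ :=
  (resolventOp (hamiltonian V K g) z (lp.single 2 n (1 : ℂ)) : Site d → ℂ) m

lemma IsResolventAt.unique {E : Type*} [NormedAddCommGroup E] [NormedSpace ℂ E] {H : E →ₗ.[ℂ] E}
    {z : ℂ} {R S : E →L[ℂ] E} (hR : IsResolventAt H z R) (hS : IsResolventAt H z S) : R = S := by
  ext φ
  obtain ⟨h, hφ⟩ := hR.1 φ
  have := hS.2 ⟨R φ, h⟩
  rw [hφ] at this
  exact this.symm

/-- `μ` is `α`-regular with constant `c`: `μ[t - ε, t + ε] ≤ c ε^α` for all `t` and `ε > 0`. -/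
def IsRegularMeasure (μ : Measure ℝ) (α c : ℝ) : Prop :=
  ∀ t ε : ℝ, 0 < ε → μ (Set.Icc (t - ε) (t + ε)) ≤ ENNReal.ofReal (c * ε ^ α)

/-- `μ` has a finite `q`-moment, bounded by `c`: `∫ |x|^q dμ(x) ≤ c`. -/
def HasMomentBound (μ : Measure ℝ) (q c : ℝ) : Prop :=
  ∫⁻ x, ENNReal.ofReal (|x| ^ q) ∂μ ≤ ENNReal.ofReal c

/-! The Hamiltonian is self-adjoint, so its resolvent exists at every non-real `z`. -/

lemma latticeDist_add_unitVec {d : ℕ} (n : Site d) (i : Fin d) :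
    latticeDist n (n + unitVec i) = 1 := by
  have : ∀ j, (n j - (n + unitVec i) j).natAbs = if j = i then 1 else 0 := by
    intro j
    by_cases h : j = i
    · subst h; simp [unitVec]
    · simp [unitVec, h]
  unfold latticeDist
  rw [Finset.sum_congr rfl fun j _ => this j]
  simp

lemma latticeDist_sub_unitVec {d : ℕ} (n : Site d) (i : Fin d) :
    latticeDist (n - unitVec i) n = 1 := by
  have := latticeDist_add_unitVec (n - unitVec i) i
  rwa [sub_add_cancel] at this

/-- The part of the hopping that goes in direction `i`. -/
noncomputable def hopF {d : ℕ} (K : Site d → Site d → ℂ) (i : Fin d) (ψ φ : Site d → ℂ)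
    (n : Site d) : ℂ :=
  (starRingEnd ℂ) (ψ n) * (K n (n + unitVec i) * φ (n + unitVec i))

lemma memlp_shift {d : ℕ} {K : Site d → ℂ} {c : ℝ} (hK : ∀ n, ‖K n‖ ≤ c) (u : Site d)
    (ψ : Ell2 d) : Memℓp (fun n => K n * ψ (n + u)) 2 := by
  have h2 : (0 : ℝ) < (2 : ℝ≥0∞).toReal := by norm_num
  have h1 : Summable fun n : Site d => ‖ψ (n + u)‖ ^ (2 : ℝ≥0∞).toReal :=
    ((lp.memℓp ψ).summable h2).comp_injective (add_left_injective u)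
  refine memℓp_gen (Summable.of_nonneg_of_le (fun n => by positivity) (fun n => ?_)
    (h1.mul_left (|c| ^ (2 : ℝ≥0∞).toReal)))
  rw [norm_mul, Real.mul_rpow (norm_nonneg _) (norm_nonneg _)]
  gcongr
  exact (hK n).trans (le_abs_self c)

lemma memlp_hop {d : ℕ} {K : Site d → Site d → ℂ} {c : ℝ} (hK : IsHopping K c) (ψ : Ell2 d) :
    Memℓp (hop K ψ) 2 := by
  have : hop K ψ = ∑ i : Fin d, ((fun n => K n (n + unitVec i) * ψ (n + unitVec i)) +
      (fun n => K n (n - unitVec i) * ψ (n - unitVec i)) : Site d → ℂ) := by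
    funext n
    simp [hop, Finset.sum_apply]
  rw [this]
  have h3 : Memℓp (fun n => ∑ i : Fin d,
      ((fun n => K n (n + unitVec i) * ψ (n + unitVec i)) +
      (fun n => K n (n - unitVec i) * ψ (n - unitVec i)) : Site d → ℂ) n) 2 := by
    apply Memℓp.finsetSum
    intro i _
    apply Memℓp.add
    · exact memlp_shift (fun n => (hK _ _ (latticeDist_add_unitVec n i)).2) _ ψ
    · have := memlp_shift (K := fun n => K n (n - unitVec i)) (c := c) (fun n => ?_)
        (-unitVec i) ψ
      · simpa [sub_eq_add_neg] using this
      · have := hK _ _ (latticeDist_sub_unitVec n i)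
        rw [this.1, RCLike.norm_conj]
        exact this.2
  convert h3 using 1
  funext n
  simp

/-- The quadratic form of the hopping is real. -/
lemma inner_hop_im {d : ℕ} {K : Site d → Site d → ℂ} {c : ℝ} (hK : IsHopping K c) (ψ : Ell2 d) :
    (inner ℂ ψ (⟨hop K ψ, memlp_hop hK ψ⟩ : Ell2 d)).im = 0 := by
  have hs : ∀ i : Fin d, Summable (hopF K i ψ ψ) := by
    intro i
    have := lp.summable_inner (𝕜 := ℂ) ψ ⟨_, memlp_shift (K := fun n => K n (n + unitVec i))
      (fun n => (hK _ _ (latticeDist_add_unitVec n i)).2) (unitVec i) ψ⟩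
    refine this.congr fun n => ?_
    simp [hopF, mul_comm]
  have hterm : ∀ i n, (starRingEnd ℂ) (ψ n) * (K n (n - unitVec i) * ψ (n - unitVec i))
      = (starRingEnd ℂ) (hopF K i ψ ψ (n - unitVec i)) := by
    intro i n
    have := (hK _ _ (latticeDist_sub_unitVec n i)).1
    simp only [hopF, map_mul, Complex.conj_conj, sub_add_cancel, this]
    ring
  have hsum : HasSum (fun n => ∑ i : Fin d, (hopF K i ψ ψ n +
      (starRingEnd ℂ) (hopF K i ψ ψ (n - unitVec i))))
      (∑ i : Fin d, (∑' n, hopF K i ψ ψ n + (starRingEnd ℂ) (∑' n, hopF K i ψ ψ n))) := by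
    apply hasSum_sum
    intro i _
    apply (hs i).hasSum.add
    have h1 : HasSum (fun n => (starRingEnd ℂ) (hopF K i ψ ψ n))
        ((starRingEnd ℂ) (∑' n, hopF K i ψ ψ n)) := (Complex.hasSum_conj' ).2 (hs i).hasSum
    exact (Equiv.subRight (unitVec i)).hasSum_iff.2 h1
  have hin := lp.hasSum_inner (𝕜 := ℂ) ψ (⟨hop K ψ, memlp_hop hK ψ⟩ : Ell2 d)
  have heq : inner ℂ ψ (⟨hop K ψ, memlp_hop hK ψ⟩ : Ell2 d) =
      ∑ i : Fin d, (∑' n, hopF K i ψ ψ n + (starRingEnd ℂ) (∑' n, hopF K i ψ ψ n)) := by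
    refine hin.unique (hsum.congr_fun ?_)
    intro n
    change inner ℂ (ψ n) (hop K ψ n) = _
    simp only [hop, RCLike.inner_apply, Finset.sum_mul]
    refine Finset.sum_congr rfl fun i _ => ?_
    rw [← hterm i n]
    simp only [hopF]
    ring
  rw [heq, Complex.im_sum]
  exact Finset.sum_eq_zero fun i _ => by simp

/-- The quadratic form of the Hamiltonian is real. -/
lemma inner_hamiltonian_im {d : ℕ} (V : Site d → ℝ) {K : Site d → Site d → ℂ} {c : ℝ}
    (hK : IsHopping K c) (g : ℝ) (ψ : (hamiltonian V K g).domain) :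
    (inner ℂ (ψ : Ell2 d) (hamiltonian V K g ψ)).im = 0 := by
  set T : Ell2 d := ⟨hop K (ψ : Ell2 d), memlp_hop hK ψ⟩ with hT
  set W : Ell2 d := hamiltonian V K g ψ - ((g⁻¹ : ℝ) : ℂ) • T with hW
  have hWn : ∀ n, (W : Site d → ℂ) n = (V n : ℂ) * (ψ : Ell2 d) n := by
    intro n
    change formalH V K g ((ψ : Ell2 d) : Site d → ℂ) n
      - ((g⁻¹ : ℝ) : ℂ) * hop K ((ψ : Ell2 d) : Site d → ℂ) n = _
    rw [formalH]
    ring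
  have h1 : (inner ℂ (ψ : Ell2 d) W).im = 0 := by
    have h := lp.hasSum_inner (𝕜 := ℂ) (ψ : Ell2 d) W
    refine (Complex.hasSum_im h).unique ?_
    convert hasSum_zero with n
    rw [hWn]
    simp only [RCLike.inner_apply]
    rw [mul_assoc, Complex.mul_conj, ← Complex.ofReal_mul, Complex.ofReal_im]
  have h2 : hamiltonian V K g ψ = W + ((g⁻¹ : ℝ) : ℂ) • T := by rw [hW]; abel
  rw [h2, inner_add_right, inner_smul_right, Complex.add_im, h1, Complex.im_ofReal_mul,
    inner_hop_im hK, mul_zero, add_zero]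

/-- Lower bound for `H - z`. -/
lemma le_norm_hamiltonian_sub {d : ℕ} (V : Site d → ℝ) {K : Site d → Site d → ℂ} {c : ℝ}
    (hK : IsHopping K c) (g : ℝ) (z : ℂ) (ψ : (hamiltonian V K g).domain) :
    |z.im| * ‖(ψ : Ell2 d)‖ ≤ ‖hamiltonian V K g ψ - z • (ψ : Ell2 d)‖ := by
  have h0 := inner_hamiltonian_im V hK g ψ
  have h1 : (inner ℂ (ψ : Ell2 d) (hamiltonian V K g ψ - z • (ψ : Ell2 d))).im
      = - (z.im * ‖(ψ : Ell2 d)‖ ^ 2) := by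
    rw [inner_sub_right, inner_smul_right, inner_self_eq_norm_sq_to_K, Complex.sub_im, h0]
    simp [← Complex.ofReal_pow]
  have h2 : |z.im| * ‖(ψ : Ell2 d)‖ ^ 2
      ≤ ‖(ψ : Ell2 d)‖ * ‖hamiltonian V K g ψ - z • (ψ : Ell2 d)‖ := by
    calc |z.im| * ‖(ψ : Ell2 d)‖ ^ 2
        = |(inner ℂ (ψ : Ell2 d) (hamiltonian V K g ψ - z • (ψ : Ell2 d))).im| := by
          rw [h1, abs_neg, abs_mul, abs_of_nonneg (sq_nonneg ‖(ψ : Ell2 d)‖)]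
      _ ≤ _ := (Complex.abs_im_le_norm _).trans (norm_inner_le_norm _ _)
  rcases (norm_nonneg (ψ : Ell2 d)).eq_or_lt with h | h
  · rw [← h, mul_zero]
    exact norm_nonneg _
  · refine le_of_mul_le_mul_left ?_ h
    calc _ = |z.im| * ‖(ψ : Ell2 d)‖ ^ 2 := by ring
      _ ≤ _ := h2

/-- `H - z` as a linear map on the domain of `H`. -/
noncomputable def shifted {d : ℕ} (V : Site d → ℝ) (K : Site d → Site d → ℂ) (g : ℝ) (z : ℂ) :
    (hamiltonian V K g).domain →ₗ[ℂ] Ell2 d :=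
  (hamiltonian V K g).toFun - z • (hamiltonian V K g).domain.subtype

lemma shifted_apply {d : ℕ} (V : Site d → ℝ) (K : Site d → Site d → ℂ) (g : ℝ) (z : ℂ)
    (ψ : (hamiltonian V K g).domain) :
    shifted V K g z ψ = hamiltonian V K g ψ - z • (ψ : Ell2 d) := rfl

lemma shifted_apply_coe {d : ℕ} (V : Site d → ℝ) (K : Site d → Site d → ℂ) (g : ℝ) (z : ℂ)
    (ψ : (hamiltonian V K g).domain) (n : Site d) :
    (shifted V K g z ψ : Site d → ℂ) n
      = formalH V K g ((ψ : Ell2 d) : Site d → ℂ) n - z * (ψ : Ell2 d) n := rfl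

lemma exists_of_formal {d : ℕ} (V : Site d → ℝ) (K : Site d → Site d → ℂ) (g : ℝ) (z : ℂ)
    (ψ φ : Ell2 d) (h : ∀ n, formalH V K g (ψ : Site d → ℂ) n - z * ψ n = φ n) :
    ∃ hψ : ψ ∈ (hamiltonian V K g).domain, shifted V K g z ⟨ψ, hψ⟩ = φ := by
  have h1 : formalH V K g (ψ : Site d → ℂ) = ((φ + z • ψ : Ell2 d) : Site d → ℂ) := by
    funext n
    rw [lp.coeFn_add, lp.coeFn_smul, Pi.add_apply, Pi.smul_apply, smul_eq_mul, ← h n]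
    ring
  refine ⟨?_, ?_⟩
  · change Memℓp (formalH V K g (ψ : Site d → ℂ)) 2
    rw [h1]
    exact lp.memℓp _
  · apply lp.ext
    funext n
    rw [shifted_apply_coe, h n]

lemma isClosed_range_shifted {d : ℕ} (V : Site d → ℝ) {K : Site d → Site d → ℂ} {c : ℝ}
    (hK : IsHopping K c) (g : ℝ) {z : ℂ} (hz : z.im ≠ 0) :
    IsClosed (LinearMap.range (shifted V K g z) : Set (Ell2 d)) := by
  have hz' : 0 < |z.im| := abs_pos.2 hz
  rw [← isSeqClosed_iff_isClosed]
  intro u φ hu hφ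
  choose ψ hψ using hu
  have hc : CauchySeq fun k => (ψ k : Ell2 d) := by
    have hu' := hφ.cauchySeq
    rw [Metric.cauchySeq_iff'] at hu' ⊢
    intro ε hε
    obtain ⟨N, hN⟩ := hu' (|z.im| * ε) (by positivity)
    refine ⟨N, fun k hk => ?_⟩
    have h1 := le_norm_hamiltonian_sub V hK g z (ψ k - ψ N)
    rw [← shifted_apply, map_sub, hψ, hψ] at h1
    have h2 := hN k hk
    rw [dist_eq_norm] at h2 ⊢
    exact lt_of_mul_lt_mul_left (h1.trans_lt h2) hz'.le
  obtain ⟨ψ', hψ'⟩ := cauchySeq_tendsto_of_complete hc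
  have hev : ∀ (x : Ell2 d) (w : ℕ → Ell2 d), Tendsto w atTop (𝓝 x) → ∀ n : Site d,
      Tendsto (fun k => (w k : Site d → ℂ) n) atTop (𝓝 ((x : Site d → ℂ) n)) := by
    intro x w hw n
    exact ((lp.lipschitzWith_one_eval 2 n).continuous.tendsto x).comp hw
  obtain ⟨h1, h2⟩ := exists_of_formal V K g z ψ' φ (fun n => by
    refine tendsto_nhds_unique ?_ (hev φ u hφ n)
    have : ∀ k, (u k : Site d → ℂ) n
        = formalH V K g ((ψ k : Ell2 d) : Site d → ℂ) n - z * (ψ k : Ell2 d) n := by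
      intro k
      rw [← hψ k, shifted_apply_coe]
    simp only [this, formalH, hop]
    have hp := hev ψ' (fun k => (ψ k : Ell2 d)) hψ'
    refine (((hp n).const_mul _).add (Tendsto.const_mul _ (tendsto_finsetSum _ fun i _ => ?_))).sub
      ((hp n).const_mul _)
    exact ((hp _).const_mul _).add ((hp _).const_mul _))
  exact ⟨_, h2⟩

lemma single_eq {d : ℕ} (n m : Site d) :
    ((lp.single 2 n (1 : ℂ) : Ell2 d) : Site d → ℂ) m = if m = n then 1 else 0 := by
  rw [lp.coeFn_single, Pi.single_apply]

lemma single_mem_domain {d : ℕ} (V : Site d → ℝ) {K : Site d → Site d → ℂ} {c : ℝ}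
    (hK : IsHopping K c) (g : ℝ) (n : Site d) :
    (lp.single 2 n (1 : ℂ) : Ell2 d) ∈ (hamiltonian V K g).domain := by
  change Memℓp (formalH V K g ((lp.single 2 n (1 : ℂ) : Ell2 d) : Site d → ℂ)) 2
  have h : formalH V K g ((lp.single 2 n (1 : ℂ) : Ell2 d) : Site d → ℂ) =
      (((V n : ℂ) • lp.single 2 n (1 : ℂ) +
        ((g⁻¹ : ℝ) : ℂ) • ⟨_, memlp_hop hK (lp.single 2 n (1 : ℂ))⟩ : Ell2 d) : Site d → ℂ) := by
    funext m
    simp only [formalH, lp.coeFn_add, lp.coeFn_smul, Pi.add_apply, Pi.smul_apply, smul_eq_mul]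
    congr 1
    rw [single_eq]
    split_ifs with hm
    · rw [hm]
    · rw [mul_zero, mul_zero]
  rw [h]
  exact lp.memℓp _

lemma inner_shifted_single {d : ℕ} (V : Site d → ℝ) {K : Site d → Site d → ℂ} {c : ℝ}
    (hK : IsHopping K c) (g : ℝ) (z : ℂ) (n : Site d) (φ : Ell2 d) :
    inner ℂ (shifted V K g z ⟨_, single_mem_domain V hK g n⟩) φ
      = formalH V K g (φ : Site d → ℂ) n - (starRingEnd ℂ) z * φ n := by
  have h : shifted V K g z ⟨_, single_mem_domain V hK g n⟩ =
      ((V n : ℂ) - z) • (lp.single 2 n (1 : ℂ) : Ell2 d) + ((g⁻¹ : ℝ) : ℂ) •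
        ∑ i : Fin d, (K (n - unitVec i) n • (lp.single 2 (n - unitVec i) (1 : ℂ) : Ell2 d)
          + K (n + unitVec i) n • (lp.single 2 (n + unitVec i) (1 : ℂ) : Ell2 d)) := by
    apply lp.ext
    funext m
    rw [shifted_apply_coe]
    simp only [formalH, hop, lp.coeFn_add, lp.coeFn_smul, lp.coeFn_sum, Pi.add_apply,
      Pi.smul_apply, Finset.sum_apply, smul_eq_mul]
    have h1 : ∀ i : Fin d, K m (m + unitVec i) *
          ((lp.single 2 n (1 : ℂ) : Ell2 d) : Site d → ℂ) (m + unitVec i)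
        = K (n - unitVec i) n *
          ((lp.single 2 (n - unitVec i) (1 : ℂ) : Ell2 d) : Site d → ℂ) m := by
      intro i
      rw [single_eq, single_eq]
      by_cases hm : m = n - unitVec i
      · simp [hm]
      · rw [if_neg hm, if_neg (fun h => hm (eq_sub_of_add_eq h)), mul_zero, mul_zero]
    have h2 : ∀ i : Fin d, K m (m - unitVec i) *
          ((lp.single 2 n (1 : ℂ) : Ell2 d) : Site d → ℂ) (m - unitVec i)
        = K (n + unitVec i) n *
          ((lp.single 2 (n + unitVec i) (1 : ℂ) : Ell2 d) : Site d → ℂ) m := by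
      intro i
      rw [single_eq, single_eq]
      by_cases hm : m = n + unitVec i
      · simp [hm]
      · rw [if_neg hm, if_neg (fun h => hm (sub_eq_iff_eq_add.1 h)), mul_zero, mul_zero]
    rw [Finset.sum_congr rfl fun i _ => congrArg₂ (· + ·) (h1 i) (h2 i), single_eq n m]
    split_ifs with hm
    · rw [hm]; ring
    · ring
  have hs : ∀ k : Site d, inner ℂ (lp.single 2 k (1 : ℂ) : Ell2 d) φ = φ k := by
    intro k
    rw [lp.inner_single_left]
    simp
  have hc : ∀ i : Fin d, (starRingEnd ℂ) (K (n - unitVec i) n) = K n (n - unitVec i) :=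
    fun i => (hK _ _ (latticeDist_sub_unitVec n i)).1.symm
  have hc' : ∀ i : Fin d, (starRingEnd ℂ) (K (n + unitVec i) n) = K n (n + unitVec i) := by
    intro i
    rw [(hK _ _ (latticeDist_add_unitVec n i)).1, Complex.conj_conj]
  rw [h]
  simp only [inner_add_left, inner_smul_left, sum_inner, hs, hc, hc', map_sub, Complex.conj_ofReal,
    formalH, hop]
  rw [Finset.sum_congr rfl fun i _ => add_comm (K n (n - unitVec i) * φ (n - unitVec i)) _]
  ring

lemma range_shifted {d : ℕ} (V : Site d → ℝ) {K : Site d → Site d → ℂ} {c : ℝ}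
    (hK : IsHopping K c) (g : ℝ) {z : ℂ} (hz : z.im ≠ 0) :
    LinearMap.range (shifted V K g z) = ⊤ := by
  have hcl := isClosed_range_shifted V hK g hz
  have : CompleteSpace (LinearMap.range (shifted V K g z)) := hcl.completeSpace_coe
  rw [← Submodule.orthogonal_eq_bot_iff, Submodule.eq_bot_iff]
  intro φ hφ
  rw [Submodule.mem_orthogonal] at hφ
  obtain ⟨h1, h2⟩ := exists_of_formal V K g ((starRingEnd ℂ) z) φ 0 (fun n => by
    rw [← inner_shifted_single V hK g z n φ]
    exact hφ _ ⟨_, rfl⟩)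
  have h3 := le_norm_hamiltonian_sub V hK g ((starRingEnd ℂ) z) ⟨φ, h1⟩
  rw [← shifted_apply, h2, norm_zero, Complex.conj_im, abs_neg] at h3
  have hz' : 0 < |z.im| := abs_pos.2 hz
  have : ‖φ‖ ≤ 0 := le_of_mul_le_mul_left (by simpa using h3) hz'
  exact norm_le_zero_iff.1 this

/-- The resolvent of the Hamiltonian exists at every non-real point. -/
theorem exists_isResolventAt {d : ℕ} (V : Site d → ℝ) {K : Site d → Site d → ℂ} {c : ℝ}
    (hK : IsHopping K c) (g : ℝ) {z : ℂ} (hz : z.im ≠ 0) :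
    ∃ R : Ell2 d →L[ℂ] Ell2 d, IsResolventAt (hamiltonian V K g) z R := by
  have hz' : 0 < |z.im| := abs_pos.2 hz
  have hinj : Function.Injective (shifted V K g z) := by
    rw [← LinearMap.ker_eq_bot, LinearMap.ker_eq_bot']
    intro ψ hψ
    have h := le_norm_hamiltonian_sub V hK g z ψ
    rw [← shifted_apply, hψ, norm_zero] at h
    have : ‖(ψ : Ell2 d)‖ ≤ 0 := le_of_mul_le_mul_left (by simpa using h) hz'
    exact Subtype.ext (norm_le_zero_iff.1 this)
  have hsur : Function.Surjective (shifted V K g z) :=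
    LinearMap.range_eq_top.1 (range_shifted V hK g hz)
  let e := LinearEquiv.ofBijective (shifted V K g z) ⟨hinj, hsur⟩
  have he : ∀ φ, shifted V K g z (e.symm φ) = φ := fun φ => e.apply_symm_apply φ
  refine ⟨LinearMap.mkContinuous ((hamiltonian V K g).domain.subtype ∘ₗ e.symm.toLinearMap)
    |z.im|⁻¹ ?_, ?_, ?_⟩
  · intro φ
    have h := le_norm_hamiltonian_sub V hK g z (e.symm φ)
    rw [← shifted_apply, he] at h
    rw [inv_mul_eq_div, le_div_iff₀' hz']
    exact h
  · intro φ
    exact ⟨(e.symm φ).2, he φ⟩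
  · intro ψ
    exact congrArg Subtype.val (e.symm_apply_apply ψ)

/-- The chosen operator is the resolvent of the Hamiltonian at every non-real point. -/
theorem isResolventAt_resolventOp {d : ℕ} (V : Site d → ℝ) {K : Site d → Site d → ℂ} {c : ℝ}
    (hK : IsHopping K c) (g : ℝ) {z : ℂ} (hz : z.im ≠ 0) :
    IsResolventAt (hamiltonian V K g) z (resolventOp (hamiltonian V K g) z) := by
  have h := exists_isResolventAt V hK g hz
  rw [resolventOp, dif_pos h]
  exact h.choose_spec

end AlloyModel

namespace AlloyModel

open scoped NNReal

/-! ### Regular measures on the line -/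

/-! Freeze every random variable except one, t = v(x), with a(m - x) ≠ 0. Moving t perturbs the
potential by a multiple of a(· - x), which lives on k sites, so by Cramer's rule G_z(m,n) =
P(t)/Q(t) with deg P, deg Q ≤ k, and Q has no real zero because z is not real
(`exists_green_eq_div`). The signs of a play no role.

The analytic core is a decoupling inequality (`exists_polynomial_decoupling`): ∫ (1+|t|)^s |P/Q|^s
dμ ≤ C ∫ |t+b|^s |P/Q|^s dμ, with C independent of P, Q and b. Compare P/Q = c ∏(t-p_i)/∏(t-r_j)
with its size A = |c| ∏(1+|p_i|)/∏(1+|r_j|). From above, |P/Q|^s is at most A^s times the weight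
(1+|t|)^(2ks) and at most k poles of order s. The q-moment pays for the weight and α-regularity for
the poles; Young's inequality balances the two exactly when s < αq/(2kα+kq). From below, with
probability at least 1/2 the variable t is bounded and stays relatively far from -b and all p_i, so
that |t+b| |P/Q| is at least a constant times (1+|b|) A.

Since V(m) - λ is a(m - x)(t + b), summing over the x that enter V(m) gives (1+|λ|)^s E|G(m,n)|^s ≤
A' E|V(m)-λ|^s |G(m,n)|^s (`lintegral_green_decoupling`). The equation (H - z)G = δ and
subadditivity of the power s ≤ 1 bound the right side by the moments at the neighbours of m. For
large g this is a strict contraction off the diagonal, and iteration yields exponential decay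
uniformly in Im z (`exists_uniform_lintegral_green_le`).

Boundary values follow from decay. By the resolvent identity, the oscillation of G over energies
λ+iε' with ε/2 ≤ ε' ≤ ε is at most 2ε times a row sum and a column sum of |G_{λ+iε}|, whose s-th
moments are bounded uniformly in ε (`enorm_green_sub_le`). Along ε = 2^(-j) these bounds are almost
surely summable, so the limit exists (`ae_exists_tendsto_green`). The moment bound at a slightly
larger exponent then makes |G|^s uniformly integrable, and the moments converge. -/

lemma IsRegularMeasure.mono {μ : Measure ℝ} {α c c' : ℝ} (h : IsRegularMeasure μ α c)
    (hc : c ≤ c') : IsRegularMeasure μ α c' := fun t ε hε =>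
  (h t ε hε).trans (ENNReal.ofReal_le_ofReal
    (mul_le_mul_of_nonneg_right hc (Real.rpow_nonneg hε.le _)))

/-- Halving the intervals improves the constant of a regular measure. -/
lemma IsRegularMeasure.halve {μ : Measure ℝ} {α c : ℝ} (h : IsRegularMeasure μ α c) :
    IsRegularMeasure μ α (c * 2 ^ (1 - α)) := by
  intro t ε hε
  have hsub : Set.Icc (t - ε) (t + ε) ⊆ Set.Icc (t - ε / 2 - ε / 2) (t - ε / 2 + ε / 2) ∪
      Set.Icc (t + ε / 2 - ε / 2) (t + ε / 2 + ε / 2) := by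
    intro x hx
    rcases le_total x t with hxt | hxt
    · left; constructor <;> [linarith [hx.1]; linarith]
    · right; constructor <;> [linarith; linarith [hx.2]]
  have hkey : c * 2 ^ (1 - α) * ε ^ α = 2 * (c * (ε / 2) ^ α) := by
    rw [Real.rpow_sub two_pos, Real.rpow_one, Real.div_rpow hε.le two_pos.le]
    ring
  calc μ (Set.Icc (t - ε) (t + ε))
      ≤ ENNReal.ofReal (c * (ε / 2) ^ α) + ENNReal.ofReal (c * (ε / 2) ^ α) :=
        (measure_mono hsub).trans ((measure_union_le _ _).trans
          (add_le_add (h _ _ (half_pos hε)) (h _ _ (half_pos hε))))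
    _ = ENNReal.ofReal (c * 2 ^ (1 - α) * ε ^ α) := by
        rw [hkey, ENNReal.ofReal_mul two_pos.le, ← two_mul]
        norm_num

lemma IsRegularMeasure.halve_iterate {μ : Measure ℝ} {α c : ℝ} (h : IsRegularMeasure μ α c)
    (n : ℕ) : IsRegularMeasure μ α (c * (2 ^ (1 - α)) ^ n) := by
  induction n with
  | zero => simpa using h
  | succ n ih => simpa [pow_succ, mul_assoc] using ih.halve

/-- The exponent of a regular nonzero measure is at most one. -/
lemma IsRegularMeasure.le_one {μ : Measure ℝ} [NeZero μ] {α c : ℝ}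
    (h : IsRegularMeasure μ α c) : α ≤ 1 := by
  by_contra! hα
  have hr : (2 : ℝ) ^ (1 - α) < 1 := Real.rpow_lt_one_of_one_lt_of_neg one_lt_two (by linarith)
  -- Each halving multiplies the constant by 2^(1-α) < 1 while the interval stays fixed, so every
  -- bounded interval is null.
  have hball : ∀ N : ℕ, μ (Set.Icc (0 - ((N : ℝ) + 1)) (0 + ((N : ℝ) + 1))) = 0 := by
    intro N
    have hlim : Tendsto (fun n : ℕ => ENNReal.ofReal (c * (2 ^ (1 - α)) ^ n * ((N : ℝ) + 1) ^ α))
        atTop (𝓝 0) := by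
      have h1 := ((tendsto_pow_atTop_nhds_zero_of_lt_one (by positivity) hr).const_mul c).mul_const
        (((N : ℝ) + 1) ^ α)
      simpa using ENNReal.tendsto_ofReal h1
    exact le_antisymm (ge_of_tendsto' hlim fun n => h.halve_iterate n _ _ (by positivity)) zero_le
  have huniv : (Set.univ : Set ℝ) = ⋃ N : ℕ, Set.Icc (0 - ((N : ℝ) + 1)) (0 + ((N : ℝ) + 1)) := by
    refine (Set.eq_univ_of_forall fun x => ?_).symm
    obtain ⟨N, hN⟩ := exists_nat_ge |x|
    have := abs_le.1 hN
    exact Set.mem_iUnion.2 ⟨N, by constructor <;> linarith⟩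
  have h0 : μ Set.univ = 0 := by
    rw [huniv]
    exact measure_iUnion_null hball
  exact NeZero.ne μ (Measure.measure_univ_eq_zero.1 h0)

/-! ### Integrability of poles, and weighted products of poles. -/

lemma setOf_norm_sub_le_subset (q : ℂ) (ε : ℝ) :
    {t : ℝ | ‖(t : ℂ) - q‖ ≤ ε} ⊆ Set.Icc (q.re - ε) (q.re + ε) := by
  intro t ht
  have h1 : |t - q.re| ≤ ε := by
    have := Complex.abs_re_le_norm ((t : ℂ) - q)
    simp only [Complex.sub_re, Complex.ofReal_re] at this
    exact this.trans ht
  have := abs_le.1 h1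
  constructor <;> linarith

lemma IsRegularMeasure.measure_norm_sub_le {μ : Measure ℝ} {α c : ℝ}
    (h : IsRegularMeasure μ α c) (q : ℂ) {ε : ℝ} (hε : 0 < ε) :
    μ {t : ℝ | ‖(t : ℂ) - q‖ ≤ ε} ≤ ENNReal.ofReal (c * ε ^ α) :=
  (measure_mono (setOf_norm_sub_le_subset q ε)).trans (h _ _ hε)

/-- Negative moments of order below the regularity exponent, uniformly in the pole. -/
lemma exists_lintegral_norm_sub_rpow_neg_le {α ρ : ℝ} (c : ℝ) (hρ : 0 < ρ) (h : ρ < α) :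
    ∃ C : ℝ≥0, ∀ μ : Measure ℝ, IsProbabilityMeasure μ → IsRegularMeasure μ α c → ∀ q : ℂ,
      ∫⁻ t, ENNReal.ofReal (‖(t : ℂ) - q‖ ^ (-ρ)) ∂μ ≤ C := by
  -- On the shell 2^(-(j+1)) < |t-q| ≤ 2^(-j) the integrand is at most w j, and u j is w j times the
  -- regularity bound for |t-q| ≤ 2^(-j). The u j form a geometric series of ratio 2^(-(α-ρ)).
  set w : ℕ → ℝ := fun j => ((1 / 2 : ℝ) ^ (j + 1)) ^ (-ρ) with hw
  have hw0 : ∀ j, 0 ≤ w j := fun j => by positivity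
  set u : ℕ → ℝ := fun j => w j * (|c| * ((1 / 2 : ℝ) ^ j) ^ α) with hu
  have hu0 : ∀ j, 0 ≤ u j := fun j => by positivity
  have hueq : ∀ j, u j = (|c| * 2 ^ ρ) * ((1 / 2 : ℝ) ^ (α - ρ)) ^ j := by
    intro j
    have h2 : (0 : ℝ) < 1 / 2 := by norm_num
    have e1 : w j = 2 ^ ρ * ((1 / 2 : ℝ) ^ (-ρ)) ^ j := by
      simp only [hw]
      rw [pow_succ, Real.mul_rpow (by positivity) h2.le, mul_comm]
      congr 1
      · rw [one_div, Real.inv_rpow two_pos.le, ← Real.rpow_neg two_pos.le, neg_neg]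
      · rw [← Real.rpow_natCast, ← Real.rpow_mul h2.le, mul_comm, Real.rpow_mul h2.le,
          Real.rpow_natCast]
    have e2 : ((1 / 2 : ℝ) ^ j) ^ α = ((1 / 2 : ℝ) ^ α) ^ j := by
      rw [← Real.rpow_natCast, ← Real.rpow_mul h2.le, mul_comm, Real.rpow_mul h2.le,
        Real.rpow_natCast]
    have e3 : (1 / 2 : ℝ) ^ (α - ρ) = (1 / 2 : ℝ) ^ (-ρ) * (1 / 2 : ℝ) ^ α := by
      rw [← Real.rpow_add h2]; congr 1; ring
    simp only [hu, e1, e2, e3, mul_pow]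
    ring
  have hus : Summable u := by
    have : u = fun j => (|c| * 2 ^ ρ) * ((1 / 2 : ℝ) ^ (α - ρ)) ^ j := funext hueq
    rw [this]
    exact (summable_geometric_of_lt_one (by positivity)
      (Real.rpow_lt_one (by norm_num) (by norm_num) (by linarith))).mul_left _
  refine ⟨1 + (∑' j, u j).toNNReal, fun μ _ hμ q => ?_⟩
  have hpt : ∀ t : ℝ, ENNReal.ofReal (‖(t : ℂ) - q‖ ^ (-ρ)) ≤ 1 + ∑' j : ℕ,
      ENNReal.ofReal (w j) *
        {t : ℝ | ‖(t : ℂ) - q‖ ≤ (1 / 2 : ℝ) ^ j}.indicator (fun _ => (1 : ℝ≥0∞)) t := by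
    intro t
    rcases le_total 1 ‖(t : ℂ) - q‖ with h1 | h1
    · refine le_add_right ?_
      rw [← ENNReal.ofReal_one]
      exact ENNReal.ofReal_le_ofReal (Real.rpow_le_one_of_one_le_of_nonpos h1 (by linarith))
    · rcases (norm_nonneg ((t : ℂ) - q)).eq_or_lt with h0 | h0
      -- At the pole itself the integrand is 0, by the convention `0 ^ (-ρ) = 0`.
      · rw [← h0, Real.zero_rpow (by linarith)]
        simp
      · obtain ⟨j, hj1, hj2⟩ := exists_nat_pow_near_of_lt_one h0 h1
          (show (0 : ℝ) < 1 / 2 by norm_num) (by norm_num)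
        refine le_add_left (le_trans ?_ (ENNReal.le_tsum j))
        rw [Set.indicator_of_mem (by exact hj2), mul_one]
        exact ENNReal.ofReal_le_ofReal
          (Real.rpow_le_rpow_of_nonpos (by positivity) hj1.le (by linarith))
  have hmeas : ∀ j : ℕ, MeasurableSet {t : ℝ | ‖(t : ℂ) - q‖ ≤ (1 / 2 : ℝ) ^ j} := fun j =>
    measurableSet_le (by fun_prop) measurable_const
  calc ∫⁻ t, ENNReal.ofReal (‖(t : ℂ) - q‖ ^ (-ρ)) ∂μ
      ≤ ∫⁻ t, (1 + ∑' j : ℕ, ENNReal.ofReal (w j) *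
        {t : ℝ | ‖(t : ℂ) - q‖ ≤ (1 / 2 : ℝ) ^ j}.indicator (fun _ => (1 : ℝ≥0∞)) t) ∂μ :=
        lintegral_mono hpt
    _ = 1 + ∑' j : ℕ, ENNReal.ofReal (w j) * μ {t : ℝ | ‖(t : ℂ) - q‖ ≤ (1 / 2 : ℝ) ^ j} := by
        rw [lintegral_add_left measurable_const, lintegral_tsum]
        · simp only [lintegral_const, measure_univ, mul_one]
          congr 1
          refine tsum_congr fun j => ?_
          rw [lintegral_const_mul _ (measurable_const.indicator (hmeas j)),
            lintegral_indicator_const (hmeas j), one_mul]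
        · exact fun j => ((measurable_const.indicator (hmeas j)).const_mul _).aemeasurable
    _ ≤ 1 + ∑' j : ℕ, ENNReal.ofReal (u j) := by
        gcongr with j
        simp only [hu]
        rw [ENNReal.ofReal_mul (hw0 j)]
        gcongr
        exact (hμ.mono (le_abs_self c)).measure_norm_sub_le q (by positivity)
    _ = _ := by
        rw [← ENNReal.ofReal_tsum_of_nonneg hu0 hus]
        simp [ENNReal.ofReal]

lemma one_add_rpow_le {x p : ℝ} (hx : 0 ≤ x) (hp : 0 ≤ p) :
    (1 + x) ^ p ≤ 2 ^ p * (1 + x ^ p) := by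
  have h1 : (1 + x) ≤ 2 * max 1 x := by
    linarith [le_max_left 1 x, le_max_right 1 x]
  calc (1 + x) ^ p ≤ (2 * max 1 x) ^ p := Real.rpow_le_rpow (by linarith) h1 hp
    _ = 2 ^ p * (max 1 x) ^ p := Real.mul_rpow two_pos.le (by positivity)
    _ ≤ _ := by
      gcongr
      rcases max_cases 1 x with ⟨h, -⟩ | ⟨h, -⟩ <;> rw [h]
      · rw [Real.one_rpow]; linarith [Real.rpow_nonneg hx p]
      · linarith

/-- Young's inequality for a weight and a product of at most `k` factors. -/
lemma rpow_mul_prod_rpow_le {κ : Type*} [Fintype κ] {k : ℕ} (hκ : Fintype.card κ ≤ k)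
    {q s : ℝ} (hk : 0 < k) (hq : 0 < q) (hs : 0 < s) (hsq : 2 * k * s / q < 1)
    {x : ℝ} (hx : 1 ≤ x) {y : κ → ℝ} (hy : ∀ j, 1 ≤ y j) :
    x ^ (2 * k * s) * ∏ j, y j ^ s ≤
      x ^ q + (1 + ∑ j, y j ^ (k * s / (1 - 2 * k * s / q))) := by
  -- Hölder split: the weight x is used to the power q with share θ, the factors y with share 1 - θ.
  -- With ρ = ks/(1-θ), a product of k factors y^s ≤ Y^(s/ρ) is exactly Y^(1-θ).
  set θ := 2 * k * s / q with hθ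
  set ρ := k * s / (1 - θ) with hρ
  have hk' : (0 : ℝ) < k := by exact_mod_cast hk
  have hθ1 : 0 < 1 - θ := by linarith
  have hθ0 : 0 ≤ θ := by positivity
  have hρ0 : 0 < ρ := by positivity
  have hterm : ∀ j, 0 ≤ y j ^ ρ := fun j => Real.rpow_nonneg (by linarith [hy j]) _
  set Y := 1 + ∑ j, y j ^ ρ with hY
  have hY1 : 1 ≤ Y := by linarith [Finset.sum_nonneg fun j (_ : j ∈ Finset.univ) => hterm j]
  have h1 : x ^ (2 * k * s) = (x ^ q) ^ θ := by
    rw [← Real.rpow_mul (by linarith), hθ]; congr 1; field_simp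
  have h2 : ∀ j, y j ^ s ≤ Y ^ (s / ρ) := by
    intro j
    have : y j ^ ρ ≤ Y := by
      linarith [Finset.single_le_sum (fun i _ => hterm i) (Finset.mem_univ j)]
    calc y j ^ s = (y j ^ ρ) ^ (s / ρ) := by
          rw [← Real.rpow_mul (by linarith [hy j])]; congr 1; field_simp
      _ ≤ _ := Real.rpow_le_rpow (hterm j) this (by positivity)
  have h3 : ∏ j, y j ^ s ≤ Y ^ (1 - θ) := by
    calc ∏ j, y j ^ s ≤ ∏ _j : κ, Y ^ (s / ρ) :=
          Finset.prod_le_prod (fun j _ => Real.rpow_nonneg (by linarith [hy j]) _)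
            fun j _ => h2 j
      _ = (Y ^ (s / ρ)) ^ Fintype.card κ := by simp
      _ ≤ (Y ^ (s / ρ)) ^ k := pow_le_pow_right₀ (Real.one_le_rpow hY1 (by positivity)) hκ
      _ = Y ^ (1 - θ) := by
          rw [← Real.rpow_natCast, ← Real.rpow_mul (by linarith)]
          congr 1
          rw [hρ]; field_simp
  have h4 := Real.geom_mean_le_arith_mean2_weighted hθ0 hθ1.le
    (Real.rpow_nonneg (by linarith : 0 ≤ x) q) (by linarith : 0 ≤ Y) (by ring)
  have hxq : 0 ≤ x ^ q := Real.rpow_nonneg (by linarith) q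
  calc x ^ (2 * k * s) * ∏ j, y j ^ s ≤ (x ^ q) ^ θ * Y ^ (1 - θ) := by
        rw [h1]; gcongr
    _ ≤ _ := h4
    _ ≤ x ^ q + Y := by nlinarith

/-- After Young's inequality only a q-th moment and separate poles of order ρ = ks/(1 - 2ks/q)
remain. The hypothesis on s is equivalent to ρ < α, the integrability of such poles; this is where
the threshold exponent comes from. -/
lemma exists_lintegral_pole_product_le {α q s : ℝ} (c c' : ℝ) {k : ℕ} (hα : 0 < α) (hq : 0 < q)
    (hs : 0 < s) (hk : 0 < k) (hs' : s * (2 * k * α + k * q) < α * q) :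
    ∃ C : ℝ≥0, ∀ μ : Measure ℝ, IsProbabilityMeasure μ → IsRegularMeasure μ α c →
      HasMomentBound μ q c' → ∀ (κ : Type) [Fintype κ], Fintype.card κ ≤ k → ∀ r : κ → ℂ,
      ∫⁻ t, ENNReal.ofReal ((1 + |t|) ^ (2 * k * s) *
        ∏ j, (1 + ‖(t : ℂ) - r j‖⁻¹) ^ s) ∂μ ≤ C := by
  have hk' : (0 : ℝ) < k := by exact_mod_cast hk
  have hθ : 2 * k * s / q < 1 := by
    rw [div_lt_one hq]
    have : 0 < s * (k * q) := by positivity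
    nlinarith
  set ρ := k * s / (1 - 2 * k * s / q) with hρ
  have hρ0 : 0 < ρ := div_pos (by positivity) (by linarith)
  have hρα : ρ < α := by
    rw [hρ, div_lt_iff₀ (by linarith)]
    have : α * (1 - 2 * k * s / q) = (α * q - 2 * k * s * α) / q := by field_simp
    rw [this, lt_div_iff₀ hq]
    nlinarith
  obtain ⟨C₁, hC₁⟩ := exists_lintegral_norm_sub_rpow_neg_le c hρ0 hρα
  refine ⟨Real.toNNReal (2 ^ q) * (1 + Real.toNNReal c') +
    (1 + k * (Real.toNNReal (2 ^ ρ) * (1 + C₁))), fun μ _ hμ hm κ _ hκ r => ?_⟩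
  have hpt : ∀ t : ℝ, ENNReal.ofReal ((1 + |t|) ^ (2 * k * s) *
      ∏ j, (1 + ‖(t : ℂ) - r j‖⁻¹) ^ s) ≤
      ENNReal.ofReal (2 ^ q) * (1 + ENNReal.ofReal (|t| ^ q)) +
        (1 + ∑ j, ENNReal.ofReal (2 ^ ρ) * (1 + ENNReal.ofReal (‖(t : ℂ) - r j‖ ^ (-ρ)))) := by
    intro t
    have h1 := rpow_mul_prod_rpow_le hκ hk hq hs hθ (x := 1 + |t|)
      (by linarith [abs_nonneg t]) (y := fun j => 1 + ‖(t : ℂ) - r j‖⁻¹)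
      (fun j => by linarith [inv_nonneg.2 (norm_nonneg ((t : ℂ) - r j))])
    have h2 := one_add_rpow_le (abs_nonneg t) hq.le
    have h3 : ∀ j, (1 + ‖(t : ℂ) - r j‖⁻¹) ^ ρ ≤ 2 ^ ρ * (1 + ‖(t : ℂ) - r j‖ ^ (-ρ)) := by
      intro j
      have := one_add_rpow_le (inv_nonneg.2 (norm_nonneg ((t : ℂ) - r j))) hρ0.le
      rwa [Real.inv_rpow (norm_nonneg _), ← Real.rpow_neg (norm_nonneg _)] at this
    refine (ENNReal.ofReal_le_ofReal (h1.trans (add_le_add h2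
      (add_le_add_right (Finset.sum_le_sum fun j _ => h3 j) 1)))).trans (le_of_eq ?_)
    rw [ENNReal.ofReal_add (by positivity) (by positivity), ENNReal.ofReal_mul (by positivity),
      ENNReal.ofReal_add (by positivity) (by positivity),
      ENNReal.ofReal_add (by positivity) (by positivity),
      ENNReal.ofReal_sum_of_nonneg (fun j _ => by positivity), ENNReal.ofReal_one]
    congr 2
    refine Finset.sum_congr rfl fun j _ => ?_
    rw [ENNReal.ofReal_mul (by positivity), ENNReal.ofReal_add (by positivity) (by positivity),
      ENNReal.ofReal_one]
  refine (lintegral_mono hpt).trans ?_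
  have m1 : ∀ j, Measurable fun t : ℝ => ENNReal.ofReal (‖(t : ℂ) - r j‖ ^ (-ρ)) := fun j => by
    fun_prop
  have m2 : Measurable fun t : ℝ => ENNReal.ofReal (|t| ^ q) := by fun_prop
  rw [lintegral_add_left (by fun_prop), lintegral_const_mul _ (by fun_prop),
    lintegral_add_left measurable_const, lintegral_add_left measurable_const,
    lintegral_finsetSum _ (fun j _ => by fun_prop)]
  simp only [lintegral_const, measure_univ, mul_one]
  push_cast
  refine add_le_add ?_ (add_le_add_right ?_ 1)
  · exact mul_le_mul_right (add_le_add_right hm 1) _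
  · have h5 : ∀ j, ∫⁻ t, ENNReal.ofReal (2 ^ ρ) *
        (1 + ENNReal.ofReal (‖(t : ℂ) - r j‖ ^ (-ρ))) ∂μ ≤ ENNReal.ofReal (2 ^ ρ) * (1 + C₁) := by
      intro j
      rw [lintegral_const_mul _ (by fun_prop), lintegral_add_left measurable_const]
      simp only [lintegral_const, measure_univ, mul_one]
      exact mul_le_mul_right (add_le_add_right (hC₁ μ inferInstance hμ _) 1) _
    refine (Finset.sum_le_sum fun j _ => h5 j).trans ?_
    rw [Finset.sum_const, Finset.card_univ, nsmul_eq_mul]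
    gcongr
    rfl

lemma exists_measure_tail_le {q : ℝ} (c' : ℝ) (hq : 0 < q) :
    ∃ R : ℝ, 1 ≤ R ∧ ∀ μ : Measure ℝ, HasMomentBound μ q c' →
      μ {t | R < |t|} ≤ ENNReal.ofReal (1 / 4) := by
  have h1 : 1 ≤ 4 * |c'| + 1 := by linarith [abs_nonneg c']
  -- Chosen so that R^q exceeds 4|c'|; Markov's inequality then gives 1/4.
  set R := (4 * |c'| + 1) ^ (1 / q) with hR
  have hRq : R ^ q = 4 * |c'| + 1 := by
    rw [hR, ← Real.rpow_mul (by linarith), one_div, inv_mul_cancel₀ hq.ne', Real.rpow_one]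
  have hR1 : 1 ≤ R := Real.one_le_rpow h1 (by positivity)
  refine ⟨R, hR1, fun μ hμ => ?_⟩
  have hsub : {t : ℝ | R < |t|} ⊆ {t | ENNReal.ofReal (R ^ q) ≤ ENNReal.ofReal (|t| ^ q)} :=
    fun t ht => ENNReal.ofReal_le_ofReal (Real.rpow_le_rpow (by linarith) (le_of_lt ht) hq.le)
  have hpos : 0 < R ^ q := by rw [hRq]; linarith
  calc μ {t | R < |t|} ≤ (∫⁻ t, ENNReal.ofReal (|t| ^ q) ∂μ) / ENNReal.ofReal (R ^ q) :=
        (measure_mono hsub).trans (meas_ge_le_lintegral_div (by fun_prop)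
          (by simpa using hpos) ENNReal.ofReal_ne_top)
    _ ≤ ENNReal.ofReal |c'| / ENNReal.ofReal (R ^ q) := by
        gcongr
        exact hμ.trans (ENNReal.ofReal_le_ofReal (le_abs_self _))
    _ = ENNReal.ofReal (|c'| / R ^ q) := (ENNReal.ofReal_div_of_pos hpos).symm
    _ ≤ _ := by
        refine ENNReal.ofReal_le_ofReal ?_
        rw [div_le_iff₀ hpos, hRq]
        linarith

/-- Most of the mass of a regular measure stays away, relatively, from any given point. -/
lemma exists_measure_near_le {α : ℝ} (c : ℝ) (hα : 0 < α) {R δ : ℝ} (hR : 1 ≤ R) (hδ : 0 < δ) :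
    ∃ η : ℝ, 0 < η ∧ ∀ μ : Measure ℝ, IsRegularMeasure μ α c → ∀ p : ℂ,
      μ {t : ℝ | |t| ≤ R ∧ ‖(t : ℂ) - p‖ < η * (1 + ‖p‖)} ≤ ENNReal.ofReal δ := by
  set ε := (δ / (|c| + 1)) ^ (1 / α) with hε
  have hc : 0 < |c| + 1 := by positivity
  have hε0 : 0 < ε := by positivity
  have hεα : ε ^ α = δ / (|c| + 1) := by
    rw [hε, ← Real.rpow_mul (by positivity), one_div, inv_mul_cancel₀ hα.ne', Real.rpow_one]
  -- If |p| ≥ 2R, then |t-p| ≥ |p|/2 ≥ (1+|p|)/4 whenever |t| ≤ R, so η ≤ 1/4 leaves nothing. If |p|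
  -- ≤ 2R, then η(1+|p|) ≤ ε, and ε is chosen with |c| ε^α ≤ δ.
  refine ⟨min (1 / 4) (ε / (2 * R + 1)), by positivity, fun μ hμ p => ?_⟩
  rcases le_total (2 * R) ‖p‖ with hp | hp
  · have : {t : ℝ | |t| ≤ R ∧ ‖(t : ℂ) - p‖ < min (1 / 4) (ε / (2 * R + 1)) * (1 + ‖p‖)} = ∅ := by
      refine Set.eq_empty_of_forall_notMem fun t ht => ?_
      obtain ⟨h1, h2⟩ := ht
      have h3 : ‖p‖ ≤ ‖(t : ℂ) - p‖ + |t| := by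
        have := norm_sub_norm_le p (t : ℂ)
        rw [norm_sub_rev, Complex.norm_real, Real.norm_eq_abs] at this
        linarith
      have h4 : min (1 / 4) (ε / (2 * R + 1)) * (1 + ‖p‖) ≤ 1 / 4 * (1 + ‖p‖) := by
        gcongr; exact min_le_left _ _
      linarith
    rw [this, measure_empty]
    exact zero_le
  · refine (measure_mono ?_).trans ((hμ.mono (le_abs_self c)).measure_norm_sub_le p hε0 |>.trans
      (ENNReal.ofReal_le_ofReal ?_))
    · rintro t ⟨-, h2⟩
      refine h2.le.trans ?_
      calc min (1 / 4) (ε / (2 * R + 1)) * (1 + ‖p‖) ≤ ε / (2 * R + 1) * (1 + 2 * R) := by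
            gcongr; exact min_le_right _ _
        _ = ε := by rw [add_comm (1 : ℝ)]; field_simp
    · rw [hεα, mul_div_assoc', div_le_iff₀ hc]
      nlinarith [abs_nonneg c]

/-! ### Rational functions on the line: size bounds and decoupling. -/

lemma norm_sub_le_mul (t : ℝ) (p : ℂ) : ‖(t : ℂ) - p‖ ≤ (1 + |t|) * (1 + ‖p‖) := by
  have h := norm_sub_le (t : ℂ) p
  rw [Complex.norm_real, Real.norm_eq_abs] at h
  nlinarith [abs_nonneg t, norm_nonneg p, mul_nonneg (abs_nonneg t) (norm_nonneg p)]

/-- A pole far from the origin is small near the origin; normalizing by 1+|r| costs only one factor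
1+|t|, uniformly in r. -/
lemma inv_norm_sub_le {t : ℝ} {r : ℂ} (h : (t : ℂ) ≠ r) :
    ‖(t : ℂ) - r‖⁻¹ ≤ (1 + ‖r‖)⁻¹ * ((1 + |t|) * (1 + ‖(t : ℂ) - r‖⁻¹)) := by
  have h0 : 0 < ‖(t : ℂ) - r‖ := norm_pos_iff.2 (sub_ne_zero.2 h)
  have h1 : 0 < 1 + ‖r‖ := by positivity
  have h2 : ‖r‖ ≤ ‖(t : ℂ) - r‖ + |t| := by
    have := norm_sub_norm_le r (t : ℂ)
    rw [norm_sub_rev, Complex.norm_real, Real.norm_eq_abs] at this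
    linarith
  rw [inv_mul_eq_div, le_div_iff₀ h1, inv_mul_eq_div, div_le_iff₀ h0]
  have : (1 + |t|) * (1 + ‖(t : ℂ) - r‖⁻¹) * ‖(t : ℂ) - r‖
      = (1 + |t|) * (‖(t : ℂ) - r‖ + 1) := by field_simp
  rw [this]
  nlinarith [abs_nonneg t, mul_nonneg (abs_nonneg t) h0.le]

/-- The rational function `c ∏ (t - pᵢ) / ∏ (t - rⱼ)` on the line. -/
noncomputable def ratFn {ι κ : Type} [Fintype ι] [Fintype κ] (c : ℂ) (p : ι → ℂ) (r : κ → ℂ)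
    (t : ℝ) : ℂ := c * (∏ i, ((t : ℂ) - p i)) * ∏ j, ((t : ℂ) - r j)⁻¹

/-- The natural size of `ratFn c p r`. -/
noncomputable def ratSize {ι κ : Type} [Fintype ι] [Fintype κ] (c : ℂ) (p : ι → ℂ) (r : κ → ℂ) :
    ℝ := ‖c‖ * (∏ i, (1 + ‖p i‖)) * ∏ j, (1 + ‖r j‖)⁻¹

section ratFn

variable {ι κ : Type} [Fintype ι] [Fintype κ] (c : ℂ) (p : ι → ℂ) (r : κ → ℂ)

lemma ratSize_nonneg : 0 ≤ ratSize c p r := by unfold ratSize; positivity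

lemma norm_ratFn (t : ℝ) : ‖ratFn c p r t‖ =
    ‖c‖ * (∏ i, ‖(t : ℂ) - p i‖) * ∏ j, ‖(t : ℂ) - r j‖⁻¹ := by
  simp [ratFn, norm_prod, norm_inv]

variable {c p r}

/-- Zeros and poles each cost at most k factors 1+|t| when normalized, hence the exponent 2k. -/
lemma norm_ratFn_le {k : ℕ} (hι : Fintype.card ι ≤ k) (hκ : Fintype.card κ ≤ k) {t : ℝ}
    (ht : ∀ j, (t : ℂ) ≠ r j) : ‖ratFn c p r t‖ ≤
      ratSize c p r * ((1 + |t|) ^ (2 * k) * ∏ j, (1 + ‖(t : ℂ) - r j‖⁻¹)) := by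
  have h1 : 1 ≤ 1 + |t| := by linarith [abs_nonneg t]
  have e1 : ∏ i, ‖(t : ℂ) - p i‖ ≤ (1 + |t|) ^ k * ∏ i, (1 + ‖p i‖) := by
    calc ∏ i, ‖(t : ℂ) - p i‖ ≤ ∏ i, ((1 + |t|) * (1 + ‖p i‖)) :=
          Finset.prod_le_prod (fun _ _ => norm_nonneg _) fun i _ => norm_sub_le_mul t (p i)
      _ = (1 + |t|) ^ Fintype.card ι * ∏ i, (1 + ‖p i‖) := by simp [Finset.prod_mul_distrib]
      _ ≤ _ := by gcongr
  have e2 : ∏ j, ‖(t : ℂ) - r j‖⁻¹ ≤ (∏ j, (1 + ‖r j‖)⁻¹) *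
      ((1 + |t|) ^ k * ∏ j, (1 + ‖(t : ℂ) - r j‖⁻¹)) := by
    calc ∏ j, ‖(t : ℂ) - r j‖⁻¹
        ≤ ∏ j, ((1 + ‖r j‖)⁻¹ * ((1 + |t|) * (1 + ‖(t : ℂ) - r j‖⁻¹))) :=
          Finset.prod_le_prod (fun _ _ => by positivity) fun j _ => inv_norm_sub_le (ht j)
      _ = (∏ j, (1 + ‖r j‖)⁻¹) *
          ((1 + |t|) ^ Fintype.card κ * ∏ j, (1 + ‖(t : ℂ) - r j‖⁻¹)) := by
          simp [Finset.prod_mul_distrib]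
      _ ≤ _ := by gcongr
  rw [norm_ratFn, ratSize]
  calc ‖c‖ * (∏ i, ‖(t : ℂ) - p i‖) * ∏ j, ‖(t : ℂ) - r j‖⁻¹
      ≤ ‖c‖ * ((1 + |t|) ^ k * ∏ i, (1 + ‖p i‖)) * ((∏ j, (1 + ‖r j‖)⁻¹) *
      ((1 + |t|) ^ k * ∏ j, (1 + ‖(t : ℂ) - r j‖⁻¹))) := by gcongr
    _ = _ := by ring

/-- Each zero loses at most a factor η by the separation hypothesis; each pole loses at most 1+R,
since |t-r| ≤ (1+R)(1+|r|). Both η and 1/(1+R) are at most 1, so fewer than k zeros or poles only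
help. -/
lemma le_norm_ratFn {k : ℕ} (hι : Fintype.card ι ≤ k) (hκ : Fintype.card κ ≤ k) {t R η : ℝ}
    (hR : 1 ≤ R) (hη : 0 < η) (hη1 : η ≤ 1) (htR : |t| ≤ R)
    (htp : ∀ i, η * (1 + ‖p i‖) ≤ ‖(t : ℂ) - p i‖) (ht : ∀ j, (t : ℂ) ≠ r j) :
    ratSize c p r * (η / (1 + R)) ^ k ≤ ‖ratFn c p r t‖ := by
  have e1 : η ^ k * ∏ i, (1 + ‖p i‖) ≤ ∏ i, ‖(t : ℂ) - p i‖ := by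
    calc η ^ k * ∏ i, (1 + ‖p i‖) ≤ η ^ Fintype.card ι * ∏ i, (1 + ‖p i‖) := by
          gcongr ?_ * _
          exact pow_le_pow_of_le_one hη.le hη1 hι
      _ = ∏ i, (η * (1 + ‖p i‖)) := by simp [Finset.prod_mul_distrib]
      _ ≤ _ := Finset.prod_le_prod (fun _ _ => by positivity) fun i _ => htp i
  have e2 : ((1 + R)⁻¹) ^ k * ∏ j, (1 + ‖r j‖)⁻¹ ≤ ∏ j, ‖(t : ℂ) - r j‖⁻¹ := by
    calc ((1 + R)⁻¹) ^ k * ∏ j, (1 + ‖r j‖)⁻¹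
        ≤ ((1 + R)⁻¹) ^ Fintype.card κ * ∏ j, (1 + ‖r j‖)⁻¹ := by
          gcongr ?_ * _
          exact pow_le_pow_of_le_one (by positivity) (inv_le_one_of_one_le₀ (by linarith)) hκ
      _ = ∏ j, ((1 + R)⁻¹ * (1 + ‖r j‖)⁻¹) := by simp [Finset.prod_mul_distrib]
      _ ≤ _ := by
          refine Finset.prod_le_prod (fun _ _ => by positivity) fun j _ => ?_
          rw [← mul_inv]
          have : 0 < ‖(t : ℂ) - r j‖ := norm_pos_iff.2 (sub_ne_zero.2 (ht j))
          gcongr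
          refine (norm_sub_le_mul t (r j)).trans ?_
          gcongr
  rw [norm_ratFn, ratSize, div_eq_mul_inv, mul_pow]
  calc ‖c‖ * (∏ i, (1 + ‖p i‖)) * (∏ j, (1 + ‖r j‖)⁻¹) * (η ^ k * (1 + R)⁻¹ ^ k)
      = ‖c‖ * (η ^ k * ∏ i, (1 + ‖p i‖)) * (((1 + R)⁻¹) ^ k * ∏ j, (1 + ‖r j‖)⁻¹) := by ring
    _ ≤ _ := by gcongr

lemma measurable_ratFn : Measurable (ratFn c p r) := by
  unfold ratFn
  refine Measurable.mul (measurable_const.mul ?_) ?_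
  · exact Finset.univ.measurable_fun_prod fun i _ => by fun_prop
  · exact Finset.univ.measurable_fun_prod fun i _ => by fun_prop

end ratFn

lemma ofReal_mul_rearrange (C : ℝ≥0) {x y z : ℝ} (hx : 0 ≤ x) (hy : 0 ≤ y) (hz : 0 < z) :
    ENNReal.ofReal x * (ENNReal.ofReal y * C) =
      2 * C * ENNReal.ofReal z⁻¹ * (ENNReal.ofReal (x * (y * z)) * ENNReal.ofReal (1 / 2)) := by
  have e1 : (2 : ℝ≥0∞) = ENNReal.ofReal 2 := by norm_num
  have e2 : (C : ℝ≥0∞) = ENNReal.ofReal C := by simp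
  rw [e1, e2, ← ENNReal.ofReal_mul hy, ← ENNReal.ofReal_mul hx, ← ENNReal.ofReal_mul two_pos.le,
    ← ENNReal.ofReal_mul (by positivity), ← ENNReal.ofReal_mul (by positivity),
    ← ENNReal.ofReal_mul (by positivity)]
  congr 1
  field_simp

/-- Decoupling for rational functions of degree at most `k`. -/
theorem exists_ratFn_decoupling {α q s : ℝ} (c c' : ℝ) {k : ℕ} (hα : 0 < α) (hq : 0 < q)
    (hs : 0 < s) (hs1 : s ≤ 1) (hk : 0 < k) (hs' : s * (2 * k * α + k * q) < α * q) :
    ∃ C : ℝ≥0, ∀ μ : Measure ℝ, IsProbabilityMeasure μ → IsRegularMeasure μ α c →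
      HasMomentBound μ q c' → ∀ (ι κ : Type) [Fintype ι] [Fintype κ], Fintype.card ι ≤ k →
      Fintype.card κ ≤ k → ∀ (a : ℂ) (p : ι → ℂ) (r : κ → ℂ), (∀ (t : ℝ) j, (t : ℂ) ≠ r j) →
      ∀ b : ℝ, ∫⁻ t, ENNReal.ofReal ((1 + |t|) ^ s * ‖ratFn a p r t‖ ^ s) ∂μ ≤
        C * ∫⁻ t, ENNReal.ofReal (|t + b| ^ s * ‖ratFn a p r t‖ ^ s) ∂μ := by
  obtain ⟨C₁, hC₁⟩ := exists_lintegral_pole_product_le c c' hα hq hs hk hs'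
  obtain ⟨R, hR, hRμ⟩ := exists_measure_tail_le c' hq
  -- There are at most k+1 points to avoid, the zeros and -b. Together they cost probability 1/4,
  -- and the tail |t| > R costs another 1/4.
  obtain ⟨η', hη', hημ'⟩ := exists_measure_near_le c hα hR
    (show (0 : ℝ) < 1 / (4 * (k + 1)) by positivity)
  set η := min η' 1 with hηdef
  have hη : 0 < η := by positivity
  have hη1 : η ≤ 1 := min_le_right _ _
  -- The k-th power is the loss in `le_norm_ratFn`; the extra η is the loss in |t+b| ≥ η(1+|b|).
  set ℓ : ℝ := (η / (1 + R)) ^ k * η with hℓ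
  have hℓ0 : 0 < ℓ := by positivity
  refine ⟨1 + 2 * C₁ * Real.toNNReal ((ℓ ^ s)⁻¹), fun μ _ hμ hm ι κ _ _ hι hκ a p r hr b => ?_⟩
  set A := ratSize a p r with hA
  have hA0 : 0 ≤ A := ratSize_nonneg a p r
  set f := ratFn a p r with hf
  have hfm : Measurable f := measurable_ratFn
  set I := ∫⁻ t, ENNReal.ofReal (|t + b| ^ s * ‖f t‖ ^ s) ∂μ with hI
  -- upper bound
  have hup : ∫⁻ t, ENNReal.ofReal (‖f t‖ ^ s) ∂μ ≤ ENNReal.ofReal (A ^ s) * C₁ := by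
    refine le_trans ?_ (mul_le_mul_right (hC₁ μ inferInstance hμ hm κ hκ r) _)
    rw [← lintegral_const_mul' _ _ ENNReal.ofReal_ne_top]
    refine lintegral_mono fun t => ?_
    rw [← ENNReal.ofReal_mul (by positivity)]
    refine ENNReal.ofReal_le_ofReal ?_
    calc ‖f t‖ ^ s ≤ (A * ((1 + |t|) ^ (2 * k) * ∏ j, (1 + ‖(t : ℂ) - r j‖⁻¹))) ^ s :=
          Real.rpow_le_rpow (norm_nonneg _) (norm_ratFn_le hι hκ (hr t)) hs.le
      _ = A ^ s * ((1 + |t|) ^ (2 * k * s) * ∏ j, (1 + ‖(t : ℂ) - r j‖⁻¹) ^ s) := by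
          rw [Real.mul_rpow hA0 (by positivity), Real.mul_rpow (by positivity) (by positivity),
            Real.finsetProd_rpow _ _ (fun j _ => by positivity), Real.rpow_mul (by positivity)]
          norm_cast
  -- lower bound
  have hlow : ENNReal.ofReal (((1 + |b|) * (A * ℓ)) ^ s) * ENNReal.ofReal (1 / 2) ≤ I := by
    -- The factor t+b is treated as one more zero, at -b.
    set p' : Option ι → ℂ := fun o => o.elim (-(b : ℂ)) p with hp'
    set bad : Set ℝ := {t | R < |t|} ∪ ⋃ o : Option ι,
      {t : ℝ | |t| ≤ R ∧ ‖(t : ℂ) - p' o‖ < η' * (1 + ‖p' o‖)} with hbad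
    have hbadμ : μ bad ≤ ENNReal.ofReal (1 / 2) := by
      have h1 : μ (⋃ o : Option ι, {t : ℝ | |t| ≤ R ∧ ‖(t : ℂ) - p' o‖ < η' * (1 + ‖p' o‖)}) ≤
          ENNReal.ofReal (1 / 4) := by
        refine (measure_iUnion_fintype_le μ _).trans ?_
        refine (Finset.sum_le_sum fun o _ => hημ' μ hμ (p' o)).trans ?_
        rw [Finset.sum_const, Finset.card_univ, Fintype.card_option, nsmul_eq_mul,
          ← ENNReal.ofReal_natCast, ← ENNReal.ofReal_mul (by positivity)]
        refine ENNReal.ofReal_le_ofReal ?_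
        have : (Fintype.card ι : ℝ) ≤ k := by exact_mod_cast hι
        push_cast
        rw [mul_one_div, div_le_div_iff₀ (by positivity) (by positivity)]
        linarith
      refine (measure_union_le _ _).trans ((add_le_add (hRμ μ hm) h1).trans (le_of_eq ?_))
      rw [← ENNReal.ofReal_add (by norm_num) (by norm_num)]
      norm_num
    have hgood : badᶜ ⊆ {t | ENNReal.ofReal (((1 + |b|) * (A * ℓ)) ^ s) ≤
        ENNReal.ofReal (|t + b| ^ s * ‖f t‖ ^ s)} := by
      intro t ht
      simp only [hbad, Set.mem_compl_iff, Set.mem_union, Set.mem_ofPred_eq, Set.mem_iUnion,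
        not_or, not_lt, not_exists, not_and] at ht
      obtain ⟨htR, htp⟩ := ht
      have hηη : ∀ o, η * (1 + ‖p' o‖) ≤ ‖(t : ℂ) - p' o‖ := fun o =>
        le_trans (by gcongr; exact min_le_left _ _) (htp o htR)
      have h1 := le_norm_ratFn (c := a) (p := p) hι hκ hR hη hη1 htR (fun i => hηη (some i)) (hr t)
      have h2 : η * (1 + |b|) ≤ |t + b| := by
        have := hηη none
        simp only [hp', Option.elim_none, sub_neg_eq_add, norm_neg, ← Complex.ofReal_add,
          Complex.norm_real, Real.norm_eq_abs] at this
        exact this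
      refine ENNReal.ofReal_le_ofReal ?_
      rw [← Real.mul_rpow (abs_nonneg _) (norm_nonneg _)]
      refine Real.rpow_le_rpow (by positivity) ?_ hs.le
      calc (1 + |b|) * (A * ℓ) = (η * (1 + |b|)) * (A * (η / (1 + R)) ^ k) := by rw [hℓ]; ring
        _ ≤ _ := mul_le_mul h2 h1 (by positivity) (abs_nonneg _)
    have hhalf : ENNReal.ofReal (1 / 2) ≤ μ badᶜ := by
      have h1 : (1 : ℝ≥0∞) ≤ μ bad + μ badᶜ := by
        rw [← measure_univ (μ := μ), ← Set.union_compl_self bad]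
        exact measure_union_le _ _
      have h2 : (1 : ℝ≥0∞) = ENNReal.ofReal (1 / 2) + ENNReal.ofReal (1 / 2) := by
        rw [← ENNReal.ofReal_add (by norm_num) (by norm_num)]; norm_num
      rw [h2] at h1
      exact (ENNReal.add_le_add_iff_left (a := ENNReal.ofReal (1 / 2)) ENNReal.ofReal_ne_top).1
        (h1.trans (add_le_add_left hbadμ _))
    calc _ ≤ ENNReal.ofReal (((1 + |b|) * (A * ℓ)) ^ s) * μ {t |
          ENNReal.ofReal (((1 + |b|) * (A * ℓ)) ^ s) ≤
          ENNReal.ofReal (|t + b| ^ s * ‖f t‖ ^ s)} := by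
          gcongr
          exact hhalf.trans (measure_mono hgood)
      _ ≤ I := mul_meas_ge_le_lintegral (by fun_prop) _
  -- Upper and lower bounds carry the same size A^s, which cancels: the constant depends on neither
  -- the zeros nor the poles.
  have hmid : ENNReal.ofReal ((1 + |b|) ^ s) * ∫⁻ t, ENNReal.ofReal (‖f t‖ ^ s) ∂μ ≤
      2 * C₁ * ENNReal.ofReal ((ℓ ^ s)⁻¹) * I := by
    calc _ ≤ ENNReal.ofReal ((1 + |b|) ^ s) * (ENNReal.ofReal (A ^ s) * C₁) := by gcongr
      _ = 2 * C₁ * ENNReal.ofReal ((ℓ ^ s)⁻¹) *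
          (ENNReal.ofReal (((1 + |b|) * (A * ℓ)) ^ s) * ENNReal.ofReal (1 / 2)) := by
          have e : ((1 + |b|) * (A * ℓ)) ^ s = (1 + |b|) ^ s * (A ^ s * ℓ ^ s) := by
            rw [Real.mul_rpow (by positivity) (by positivity), Real.mul_rpow hA0 hℓ0.le]
          rw [e]
          exact ofReal_mul_rearrange C₁ (by positivity) (by positivity) (by positivity)
      _ ≤ _ := by gcongr
  -- Split 1+|t| ≤ |t+b| + (1+|b|) and apply the subadditive power s ≤ 1; the second term is
  -- controlled by `hmid`.
  calc ∫⁻ t, ENNReal.ofReal ((1 + |t|) ^ s * ‖f t‖ ^ s) ∂μ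
      ≤ ∫⁻ t, (ENNReal.ofReal (|t + b| ^ s * ‖f t‖ ^ s) +
          ENNReal.ofReal ((1 + |b|) ^ s) * ENNReal.ofReal (‖f t‖ ^ s)) ∂μ := by
        refine lintegral_mono fun t => ?_
        rw [← ENNReal.ofReal_mul (by positivity),
          ← ENNReal.ofReal_add (by positivity) (by positivity), ← add_mul]
        refine ENNReal.ofReal_le_ofReal (mul_le_mul_of_nonneg_right ?_ (by positivity))
        refine le_trans (Real.rpow_le_rpow (by positivity) ?_ hs.le)
          (Real.rpow_add_le_add_rpow (abs_nonneg _) (by positivity) hs.le hs1)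
        have := abs_sub (t + b) b
        rw [add_sub_cancel_right] at this
        linarith
    _ = I + ENNReal.ofReal ((1 + |b|) ^ s) * ∫⁻ t, ENNReal.ofReal (‖f t‖ ^ s) ∂μ := by
        rw [lintegral_add_left (by fun_prop), lintegral_const_mul _ (by fun_prop)]
    _ ≤ I + 2 * C₁ * ENNReal.ofReal ((ℓ ^ s)⁻¹) * I := by gcongr
    _ = _ := by
        push_cast
        rw [add_mul, one_mul]
        rfl

/-- Decoupling for quotients of polynomials of degree at most `k`. -/
theorem exists_polynomial_decoupling {α q s : ℝ} (c c' : ℝ) {k : ℕ} (hα : 0 < α) (hq : 0 < q)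
    (hs : 0 < s) (hs1 : s ≤ 1) (hk : 0 < k) (hs' : s * (2 * k * α + k * q) < α * q) :
    ∃ C : ℝ≥0, ∀ μ : Measure ℝ, IsProbabilityMeasure μ → IsRegularMeasure μ α c →
      HasMomentBound μ q c' → ∀ P Q : Polynomial ℂ, P.natDegree ≤ k → Q.natDegree ≤ k →
      (∀ t : ℝ, Q.eval (t : ℂ) ≠ 0) → ∀ b : ℝ,
      ∫⁻ t, ENNReal.ofReal ((1 + |t|) ^ s * ‖P.eval (t : ℂ) / Q.eval (t : ℂ)‖ ^ s) ∂μ ≤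
        C * ∫⁻ t, ENNReal.ofReal (|t + b| ^ s * ‖P.eval (t : ℂ) / Q.eval (t : ℂ)‖ ^ s) ∂μ := by
  classical
  obtain ⟨C, hC⟩ := exists_ratFn_decoupling c c' hα hq hs hs1 hk hs'
  refine ⟨C, fun μ hμ hr hm P Q hP hQ hQ0 b => ?_⟩
  -- Indexing by the multiset of roots keeps multiplicities.
  have heval : ∀ (S : Polynomial ℂ) (x : ℂ), S.eval x =
      S.leadingCoeff * ∏ i : S.roots, (x - i.1) := by
    intro S x
    rw [(IsAlgClosed.splits S).eval_eq_prod_roots, Finset.prod,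
      Multiset.map_univ S.roots fun y => x - y]
  have hcard : ∀ S : Polynomial ℂ, S.natDegree ≤ k → Fintype.card S.roots ≤ k := fun S hS => by
    rw [Multiset.card_coe]
    exact S.card_roots'.trans hS
  have hQroots : ∀ (t : ℝ) (j : Q.roots), (t : ℂ) ≠ j.1 := by
    intro t j h
    have : j.1 ∈ Q.roots := Multiset.coe_mem
    exact hQ0 t (by rw [h]; exact (Polynomial.mem_roots'.1 this).2)
  have := hC μ hμ hr hm P.roots Q.roots (hcard P hP) (hcard Q hQ)
    (P.leadingCoeff / Q.leadingCoeff) (fun i => i.1) (fun j => j.1) hQroots b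
  have hfun : ∀ t : ℝ, ratFn (P.leadingCoeff / Q.leadingCoeff) (fun i : P.roots => i.1)
      (fun j : Q.roots => j.1) t = P.eval (t : ℂ) / Q.eval (t : ℂ) := by
    intro t
    rw [heval P, heval Q, ratFn, Finset.prod_inv_distrib]
    simp only [div_eq_mul_inv, mul_inv]
    ring
  simpa only [hfun] using this

/-! ### Resolvents of the Hamiltonian -/

section resolvent

variable {d : ℕ} (V : Site d → ℝ) {K : Site d → Site d → ℂ} {c : ℝ} (hK : IsHopping K c) (g : ℝ)
  {z : ℂ} (hz : z.im ≠ 0)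

include hK hz

lemma formalH_resolventOp (φ : Ell2 d) (n : Site d) :
    formalH V K g (resolventOp (hamiltonian V K g) z φ : Site d → ℂ) n -
      z * (resolventOp (hamiltonian V K g) z φ : Site d → ℂ) n = φ n := by
  obtain ⟨h, h'⟩ := (isResolventAt_resolventOp V hK g hz).1 φ
  exact congrFun (congrArg (fun ψ : Ell2 d => (ψ : Site d → ℂ)) h') n

lemma resolventOp_eq_of_formalH {ψ φ : Ell2 d}
    (h : ∀ n, formalH V K g (ψ : Site d → ℂ) n - z * ψ n = φ n) :
    resolventOp (hamiltonian V K g) z φ = ψ := by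
  obtain ⟨hψ, h'⟩ := exists_of_formal V K g z ψ φ h
  rw [← h']
  exact (isResolventAt_resolventOp V hK g hz).2 ⟨ψ, hψ⟩

lemma norm_resolventOp_apply_le (φ : Ell2 d) :
    ‖resolventOp (hamiltonian V K g) z φ‖ ≤ |z.im|⁻¹ * ‖φ‖ := by
  obtain ⟨h, h'⟩ := (isResolventAt_resolventOp V hK g hz).1 φ
  have h1 := le_norm_hamiltonian_sub V hK g z ⟨_, h⟩
  rw [h'] at h1
  rw [inv_mul_eq_div, le_div_iff₀' (abs_pos.2 hz)]
  exact h1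

/-- The first resolvent identity. -/
lemma resolventOp_eq_resolventOp_add {w : ℂ} (hw : w.im ≠ 0) (φ : Ell2 d) :
    resolventOp (hamiltonian V K g) z φ = resolventOp (hamiltonian V K g) w
      (φ + (z - w) • resolventOp (hamiltonian V K g) z φ) := by
  symm
  refine resolventOp_eq_of_formalH V hK g hw fun n => ?_
  have := formalH_resolventOp V hK g hz φ n
  rw [lp.coeFn_add, lp.coeFn_smul, Pi.add_apply, Pi.smul_apply, smul_eq_mul, ← this]
  ring

/-- The equation satisfied by the columns of the Green function. -/
lemma green_equation (m n : Site d) :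
    ((V m : ℂ) - z) * green V K g z m n + ((g⁻¹ : ℝ) : ℂ) * hop K (fun x => green V K g z x n) m =
      if m = n then 1 else 0 := by
  have h := formalH_resolventOp V hK g hz (lp.single 2 n (1 : ℂ)) m
  rw [single_eq, formalH] at h
  rw [← h]
  change _ = (V m : ℂ) * green V K g z m n + ((g⁻¹ : ℝ) : ℂ) *
    hop K (fun x => green V K g z x n) m - z * green V K g z m n
  ring

lemma norm_green_le (m n : Site d) : ‖green V K g z m n‖ ≤ |z.im|⁻¹ := by
  have h1 := norm_resolventOp_apply_le V hK g hz (lp.single 2 n (1 : ℂ))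
  rw [lp.norm_single (by norm_num), norm_one, mul_one] at h1
  exact (lp.norm_apply_le_norm (by norm_num) _ m).trans h1

/-- The second resolvent identity for a perturbation of the potential supported in a finite set. -/
lemma green_perturbation (D : Site d → ℝ) (T : Finset (Site d)) (hT : ∀ x, D x ≠ 0 → x ∈ T)
    (t : ℝ) (m n : Site d) :
    green (fun x => V x + t * D x) K g z m n + ∑ w ∈ T, (t * (green V K g z m w * D w)) *
      green (fun x => V x + t * D x) K g z w n = green V K g z m n := by
  classical
  set W : Site d → ℝ := fun x => V x + t * D x
  set ψ := resolventOp (hamiltonian W K g) z (lp.single 2 n (1 : ℂ)) with hψ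
  -- χ is tDψ, so (H_V - z)ψ = δ_n - χ; applying the resolvent of H_V gives the identity.
  set χ : Ell2 d := ∑ w ∈ T, ((t * D w : ℝ) * (ψ : Site d → ℂ) w) •
    (lp.single 2 w (1 : ℂ) : Ell2 d) with hχ
  have hχn : ∀ x, (χ : Site d → ℂ) x = (t * D x : ℝ) * (ψ : Site d → ℂ) x := by
    intro x
    simp only [hχ, lp.coeFn_sum, Finset.sum_apply, lp.coeFn_smul, Pi.smul_apply, single_eq,
      smul_eq_mul, mul_ite, mul_one, mul_zero]
    rw [Finset.sum_ite_eq]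
    split_ifs with hx
    · rfl
    · have : D x = 0 := by_contra fun h => hx (hT x h)
      simp [this]
  have h1 : resolventOp (hamiltonian V K g) z (lp.single 2 n (1 : ℂ) - χ) = ψ := by
    refine resolventOp_eq_of_formalH V hK g hz fun x => ?_
    have := formalH_resolventOp W hK g hz (lp.single 2 n (1 : ℂ)) x
    rw [lp.coeFn_sub, Pi.sub_apply, hχn, ← this, ← hψ]
    simp only [formalH, W]
    push_cast
    ring
  have h2 : (ψ : Site d → ℂ) m = (resolventOp (hamiltonian V K g) z
      (lp.single 2 n (1 : ℂ) - χ) : Site d → ℂ) m := by rw [h1]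
  rw [map_sub, hχ, map_sum, lp.coeFn_sub, Pi.sub_apply, lp.coeFn_sum, Finset.sum_apply] at h2
  simp only [map_smul, lp.coeFn_smul, Pi.smul_apply, smul_eq_mul] at h2
  change (ψ : Site d → ℂ) m + ∑ w ∈ T, (t * (green V K g z m w * D w)) * (ψ : Site d → ℂ) w = _
  rw [h2, green, sub_add_eq_add_sub, sub_eq_iff_eq_add]
  congr 1
  refine Finset.sum_congr rfl fun w _ => ?_
  rw [green]
  push_cast
  ring

/-- The resolvent depends strongly continuously on the potential. -/
lemma tendsto_resolventOp (φ : Ell2 d) :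
    Tendsto (fun W : Site d → ℝ => resolventOp (hamiltonian W K g) z φ) (𝓝 V)
      (𝓝 (resolventOp (hamiltonian V K g) z φ)) := by
  have hz' : 0 < |z.im| := abs_pos.2 hz
  -- N collects the vectors on which the resolvents converge. The uniform bound 1/|Im z| makes it
  -- closed, so convergence on a total set suffices.
  let N : Submodule ℂ (Ell2 d) :=
    { carrier := {φ | Tendsto (fun W : Site d → ℝ => resolventOp (hamiltonian W K g) z φ) (𝓝 V)
        (𝓝 (resolventOp (hamiltonian V K g) z φ))}
      zero_mem' := by simp
      add_mem' := fun {φ ψ} h₁ h₂ => by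
        simp only [Set.mem_ofPred_eq, map_add] at h₁ h₂ ⊢
        exact h₁.add h₂
      smul_mem' := fun a {φ} h => by
        simp only [Set.mem_ofPred_eq, map_smul] at h ⊢
        exact h.const_smul a }
  have hclosed : N.topologicalClosure ≤ N := by
    intro φ hφ
    rw [← SetLike.mem_coe, Submodule.topologicalClosure_coe] at hφ
    change Tendsto _ _ _
    rw [Metric.tendsto_nhds]
    intro ε hε
    obtain ⟨χ, hχN, hχ⟩ := Metric.mem_closure_iff.1 hφ (|z.im| * (ε / 3)) (by positivity)
    have hχ' : Tendsto (fun W : Site d → ℝ => resolventOp (hamiltonian W K g) z χ) (𝓝 V)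
        (𝓝 (resolventOp (hamiltonian V K g) z χ)) := hχN
    have hdist : ∀ W : Site d → ℝ, dist (resolventOp (hamiltonian W K g) z φ)
        (resolventOp (hamiltonian W K g) z χ) < ε / 3 := by
      intro W
      rw [dist_eq_norm, ← map_sub]
      refine (norm_resolventOp_apply_le W hK g hz _).trans_lt ?_
      rw [inv_mul_lt_iff₀ hz', ← dist_eq_norm]
      exact hχ
    filter_upwards [Metric.tendsto_nhds.1 hχ' (ε / 3) (by positivity)] with W hW
    have h1 := hdist W
    have h2 := hdist V
    rw [dist_comm] at h2
    have := dist_triangle4 (resolventOp (hamiltonian W K g) z φ)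
      (resolventOp (hamiltonian W K g) z χ) (resolventOp (hamiltonian V K g) z χ)
      (resolventOp (hamiltonian V K g) z φ)
    linarith
  -- On (H_V - z)δ_n convergence is explicit: R_W (H_V - z)δ_n = δ_n + (V(n) - W(n)) R_W δ_n, and
  -- only the single value W(n) matters.
  have hmem : ∀ n, shifted V K g z ⟨_, single_mem_domain V hK g n⟩ ∈ N := by
    intro n
    set δ : Ell2 d := lp.single 2 n (1 : ℂ) with hδ
    have hval : ∀ W : Site d → ℝ, resolventOp (hamiltonian W K g) z
        (shifted V K g z ⟨_, single_mem_domain V hK g n⟩) =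
        δ + ((V n - W n : ℝ) : ℂ) • resolventOp (hamiltonian W K g) z δ := by
      intro W
      have h1 : shifted V K g z ⟨δ, single_mem_domain V hK g n⟩ =
          shifted W K g z ⟨δ, single_mem_domain W hK g n⟩ + ((V n - W n : ℝ) : ℂ) • δ := by
        apply lp.ext
        funext x
        rw [lp.coeFn_add, lp.coeFn_smul, Pi.add_apply, Pi.smul_apply, shifted_apply_coe,
          shifted_apply_coe, smul_eq_mul]
        simp only [formalH, hδ, single_eq]
        split_ifs with hx
        · subst hx; push_cast; ring
        · ring
      rw [h1, map_add, map_smul]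
      congr 1
      exact (isResolventAt_resolventOp W hK g hz).2 ⟨δ, single_mem_domain W hK g n⟩
    change Tendsto _ _ _
    simp only [hval, sub_self, Complex.ofReal_zero, zero_smul]
    refine tendsto_const_nhds.add ?_
    refine squeeze_zero_norm (a := fun W : Site d → ℝ => |V n - W n| * (|z.im|⁻¹ * ‖δ‖))
      (fun W => ?_) ?_
    · rw [norm_smul, Complex.norm_real, Real.norm_eq_abs]
      exact mul_le_mul_of_nonneg_left (norm_resolventOp_apply_le W hK g hz δ) (abs_nonneg _)
    · have h1 : Continuous fun W : Site d → ℝ => |V n - W n| * (|z.im|⁻¹ * ‖δ‖) := by fun_prop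
      have := h1.tendsto V
      simpa using this
  -- These vectors span a dense subspace: anything orthogonal to them is an ℓ² solution of (H - z̄)χ
  -- = 0, which vanishes by the lower bound.
  have htop : N.topologicalClosure = ⊤ := by
    rw [Submodule.topologicalClosure_eq_top_iff, Submodule.eq_bot_iff]
    intro χ hχ
    rw [Submodule.mem_orthogonal] at hχ
    obtain ⟨h1, h2⟩ := exists_of_formal V K g ((starRingEnd ℂ) z) χ 0 (fun n => by
      rw [← inner_shifted_single V hK g z n χ]
      exact hχ _ (hmem n))
    have h3 := le_norm_hamiltonian_sub V hK g ((starRingEnd ℂ) z) ⟨χ, h1⟩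
    rw [← shifted_apply, h2, norm_zero, Complex.conj_im, abs_neg] at h3
    have : ‖χ‖ ≤ 0 := le_of_mul_le_mul_left (by simpa using h3) hz'
    exact norm_le_zero_iff.1 this
  have : φ ∈ N := hclosed (htop ▸ Submodule.mem_top)
  exact this

/-- Continuity is for the product topology on potentials; it supplies the measurability of the Green
function in the random variables. -/
lemma continuous_green (m n : Site d) :
    Continuous fun V : Site d → ℝ => green V K g z m n :=
  continuous_iff_continuousAt.2 fun V =>
    ((lp.lipschitzWith_one_eval 2 m).continuous.tendsto _).comp
      (tendsto_resolventOp V hK g hz (lp.single 2 n (1 : ℂ)))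

end resolvent

/-! ### Rational dependence on a finite-rank perturbation -/

/-- Every term of the Leibniz expansion takes one entry from each column, so column-wise degree
bounds add up. -/
lemma natDegree_det_le_sum {ι R : Type*} [Fintype ι] [DecidableEq ι] [CommRing R]
    (M : Matrix ι ι (Polynomial R)) (e : ι → ℕ) (h : ∀ i j, (M i j).natDegree ≤ e j) :
    M.det.natDegree ≤ ∑ j, e j := by
  rw [Matrix.det_apply]
  refine Polynomial.natDegree_sum_le_of_forall_le _ _ fun σ _ => ?_
  refine (Polynomial.natDegree_smul_le _ _).trans ?_
  refine (Polynomial.natDegree_prod_le _ _).trans ?_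
  exact Finset.sum_le_sum fun j _ => h _ _

lemma eval_det {ι R : Type*} [Fintype ι] [DecidableEq ι] [CommRing R]
    (M : Matrix ι ι (Polynomial R)) (x : R) :
    M.det.eval x = (M.map (Polynomial.eval x)).det := by
  have := RingHom.map_det (Polynomial.evalRingHom x) M
  simpa using this

/-- A family of solutions of `(1 + t A) y = b` is rational in `t`, of degree at most the number of
nonzero columns of `A`. -/
lemma exists_polynomial_cramer {ι : Type*} [Fintype ι] [DecidableEq ι] (A : Matrix ι ι ℂ)
    (b : ι → ℂ) (i : ι) (S : Finset ι) (hS : ∀ u, ∀ w ∉ S, A u w = 0)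
    (hdet : ∀ t : ℝ, (1 + (t : ℂ) • A).det ≠ 0) :
    ∃ P Q : Polynomial ℂ, P.natDegree ≤ S.card ∧ Q.natDegree ≤ S.card ∧
      (∀ t : ℝ, Q.eval (t : ℂ) ≠ 0) ∧ ∀ (t : ℝ) (y : ι → ℂ),
        (1 + (t : ℂ) • A).mulVec y = b → y i = P.eval (t : ℂ) / Q.eval (t : ℂ) := by
  set M : Matrix ι ι (Polynomial ℂ) :=
    (1 : Matrix ι ι (Polynomial ℂ)) + Matrix.of fun u w => Polynomial.X * Polynomial.C (A u w)
    with hM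
  -- Columns outside S do not involve t, so they contribute degree 0. Replacing a column by the
  -- constant b, as Cramer's rule does, cannot raise these bounds.
  set e : ι → ℕ := fun w => if w ∈ S then 1 else 0 with he
  have hesum : ∑ w, e w = S.card := by simp [he]
  have hMdeg : ∀ u w, (M u w).natDegree ≤ e w := by
    intro u w
    have h1 : ((1 : Matrix ι ι (Polynomial ℂ)) u w).natDegree ≤ e w := by
      rw [Matrix.one_apply]
      split_ifs <;> simp
    refine (Polynomial.natDegree_add_le _ _).trans (max_le h1 ?_)
    change (Polynomial.X * Polynomial.C (A u w)).natDegree ≤ e w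
    by_cases hw : w ∈ S
    · simp only [he, hw, if_true]
      refine (Polynomial.natDegree_mul_le).trans ?_
      simp
    · simp [hS u w hw]
  have hMeval : ∀ t : ℂ, M.map (Polynomial.eval t) = 1 + t • A := by
    intro t
    ext u w
    simp only [hM, Matrix.map_apply, Matrix.add_apply, Matrix.of_apply, Matrix.smul_apply,
      Polynomial.eval_add, Polynomial.eval_mul, Polynomial.eval_X, Polynomial.eval_C, smul_eq_mul,
      Matrix.one_apply]
    split_ifs <;> simp
  have hNdeg : ∀ u w, ((M.updateCol i fun u => Polynomial.C (b u)) u w).natDegree ≤ e w := by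
    intro u w
    rw [Matrix.updateCol_apply]
    split_ifs
    · simp
    · exact hMdeg u w
  have hNeval : ∀ t : ℂ, (M.updateCol i fun u => Polynomial.C (b u)).map (Polynomial.eval t) =
      (1 + t • A).updateCol i b := by
    intro t
    rw [← hMeval]
    ext u w
    simp only [Matrix.map_apply, Matrix.updateCol_apply]
    split_ifs <;> simp
  refine ⟨(M.updateCol i fun u => Polynomial.C (b u)).det, M.det,
    hesum ▸ natDegree_det_le_sum _ e hNdeg, hesum ▸ natDegree_det_le_sum _ e hMdeg,
    fun t => ?_, fun t y hy => ?_⟩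
  · rw [eval_det, hMeval]; exact hdet t
  · rw [eval_det, eval_det, hMeval, hNeval, eq_div_iff (hdet t), ← Matrix.cramer_apply, ← hy,
      Matrix.cramer_eq_adjugate_mulVec, Matrix.mulVec_mulVec, Matrix.adjugate_mul,
      Matrix.smul_mulVec, Matrix.one_mulVec, Pi.smul_apply, smul_eq_mul, mul_comm]

/-- The Green function is a rational function of the strength of a finite-rank perturbation. -/
theorem exists_green_eq_div {d : ℕ} (V : Site d → ℝ) {K : Site d → Site d → ℂ} {c : ℝ}
    (hK : IsHopping K c) (g : ℝ) {z : ℂ} (hz : z.im ≠ 0) (D : Site d → ℝ) (S : Finset (Site d))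
    (hS : ∀ x, D x ≠ 0 → x ∈ S) (m n : Site d) :
    ∃ P Q : Polynomial ℂ, P.natDegree ≤ S.card ∧ Q.natDegree ≤ S.card ∧
      (∀ t : ℝ, Q.eval (t : ℂ) ≠ 0) ∧ ∀ t : ℝ, green (fun x => V x + t * D x) K g z m n =
        P.eval (t : ℂ) / Q.eval (t : ℂ) := by
  classical
  -- The site m is added so that the wanted entry is among the unknowns. If D vanishes there its
  -- column is zero, so the degree is unaffected.
  set T := insert m S with hT
  have hTD : ∀ x, D x ≠ 0 → x ∈ T := fun x hx => Finset.mem_insert_of_mem (hS x hx)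
  set A : Matrix T T ℂ := Matrix.of fun u w => green V K g z u w * D w with hA
  have key : ∀ (t : ℝ) (u : T) (n : Site d), green (fun x => V x + t * D x) K g z u n +
      ∑ w : T, (t * A u w) * green (fun x => V x + t * D x) K g z w n = green V K g z u n := by
    intro t u n
    rw [← green_perturbation V hK g hz D T hTD t u n, ← Finset.sum_coe_sort T]
    rfl
  have hdet : ∀ t : ℝ, (1 + (t : ℂ) • A).det ≠ 0 := by
    intro t
    -- The perturbed Green function provides the inverse: (1 + tA)(1 - tB) = 1. Hence the
    -- determinant has no real zero.
    set B : Matrix T T ℂ :=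
      Matrix.of fun u w => green (fun x => V x + t * D x) K g z u w * D w with hB
    have hBA : B + (t : ℂ) • (A * B) = A := by
      ext u w
      have := congrArg (· * (D w : ℂ)) (key t u w)
      simp only [add_mul, Finset.sum_mul] at this
      simp only [Matrix.add_apply, Matrix.smul_apply, Matrix.mul_apply, smul_eq_mul,
        Finset.mul_sum]
      rw [show A u w = green V K g z u w * D w from rfl, ← this]
      congr 1
      refine Finset.sum_congr rfl fun x _ => ?_
      simp only [hB, Matrix.of_apply]
      ring
    have hprod : (1 + (t : ℂ) • A) * (1 - (t : ℂ) • B) = 1 := by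
      have : (1 + (t : ℂ) • A) * (1 - (t : ℂ) • B) =
          1 + (t : ℂ) • (A - (B + (t : ℂ) • (A * B))) := by
        simp only [add_mul, mul_sub, one_mul, mul_one, smul_mul_assoc, mul_smul_comm, smul_sub,
          smul_add]
        abel
      rw [this, hBA, sub_self, smul_zero, add_zero]
    intro h0
    have := congrArg Matrix.det hprod
    rw [Matrix.det_mul, h0, zero_mul, Matrix.det_one] at this
    exact zero_ne_one this
  set S' : Finset T := Finset.univ.filter fun w => D w ≠ 0 with hS'
  have hcard : S'.card ≤ S.card := by
    refine Finset.card_le_card_of_injOn (fun w => (w : Site d)) (fun w hw => ?_)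
      Subtype.val_injective.injOn
    rw [Finset.mem_coe, hS', Finset.mem_filter] at hw
    exact hS _ hw.2
  obtain ⟨P, Q, hP, hQ, hQ0, hPQ⟩ := exists_polynomial_cramer A (fun u => green V K g z u n)
    ⟨m, Finset.mem_insert_self m S⟩ S' (fun u w hw => by
      have : D w = 0 := by simpa [hS'] using hw
      simp [hA, this]) hdet
  refine ⟨P, Q, hP.trans hcard, hQ.trans hcard, hQ0, fun t => ?_⟩
  refine hPQ t (fun u => green (fun x => V x + t * D x) K g z u n) ?_
  funext u
  rw [← key t u n, Matrix.add_mulVec, Matrix.one_mulVec, Pi.add_apply]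
  simp only [Matrix.mulVec, dotProduct, Matrix.smul_apply, smul_eq_mul]

/-! ### Independence: integrating out a single coordinate -/

/-- Setting coordinate x to 0 makes the whole family measurable with respect to the variables
indexed by the complement of x, so independence of disjoint groups applies. -/
lemma indepFun_update_zero {ι Ω : Type*} [DecidableEq ι] {mΩ : MeasurableSpace Ω} {P : Measure Ω}
    {v : ι → Ω → ℝ} (hv : ∀ i, Measurable (v i)) (hind : iIndepFun v P) (x : ι) :
    IndepFun (fun ω => Function.update (fun y => v y ω) x 0) (v x) P := by
  have h := indep_iSup_of_disjoint (fun i => (hv i).comap_le) hind.iIndep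
    (S := {x}ᶜ) (T := {x}) (disjoint_compl_left)
  rw [IndepFun_iff_Indep]
  refine indep_of_indep_of_le_left (indep_of_indep_of_le_right h ?_) ?_
  · exact le_iSup₂_of_le x rfl le_rfl
  · apply Measurable.comap_le
    refine @measurable_pi_lambda _ _ _ (_) _ _ fun y => ?_
    by_cases hy : y = x
    · subst hy
      simp only [Function.update_self]
      exact measurable_const
    · simp only [Function.update_of_ne hy]
      exact (comap_measurable (v y)).mono (le_iSup₂_of_le y hy le_rfl) le_rfl

/-- Fubini for the pair (all other variables, v x). It is stated with an update of the full family,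
so that the ambient space Ω need not be a product. -/
lemma lintegral_eq_lintegral_update {ι Ω : Type*} [DecidableEq ι] {mΩ : MeasurableSpace Ω}
    {P : Measure Ω} [IsProbabilityMeasure P] {v : ι → Ω → ℝ} (hv : ∀ i, Measurable (v i))
    (hind : iIndepFun v P) (x : ι) {F : (ι → ℝ) → ℝ≥0∞} (hF : Measurable F) :
    ∫⁻ ω, F (fun y => v y ω) ∂P =
      ∫⁻ ω, ∫⁻ t, F (Function.update (fun y => v y ω) x t) ∂(P.map (v x)) ∂P := by
  set r : Ω → ι → ℝ := fun ω => Function.update (fun y => v y ω) x 0 with hr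
  have hrm : Measurable r := by
    refine measurable_pi_iff.2 fun y => ?_
    by_cases hy : y = x
    · subst hy
      simp only [hr, Function.update_self]
      exact measurable_const
    · simp only [hr, Function.update_of_ne hy]
      exact hv y
  have hF' : Measurable fun p : (ι → ℝ) × ℝ => F (Function.update p.1 x p.2) :=
    hF.comp measurable_update'
  have hprob : IsProbabilityMeasure (P.map (v x)) :=
    Measure.isProbabilityMeasure_map (hv x).aemeasurable
  have hprod := (indepFun_iff_map_prod_eq_prod_map_map hrm.aemeasurable (hv x).aemeasurable).1
    (indepFun_update_zero hv hind x)
  have hup : ∀ ω t, Function.update (r ω) x t = Function.update (fun y => v y ω) x t := by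
    intro ω t
    simp [hr]
  calc ∫⁻ ω, F (fun y => v y ω) ∂P = ∫⁻ ω, F (Function.update (r ω) x (v x ω)) ∂P := by
        refine lintegral_congr fun ω => ?_
        rw [hup]
        congr 1
        exact (Function.update_eq_self x _).symm
    _ = ∫⁻ p, F (Function.update p.1 x p.2) ∂(P.map fun ω => (r ω, v x ω)) :=
        (lintegral_map hF' (hrm.prodMk (hv x))).symm
    _ = ∫⁻ ρ, ∫⁻ t, F (Function.update ρ x t) ∂(P.map (v x)) ∂(P.map r) := by
        rw [hprod, lintegral_prod _ hF'.aemeasurable]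
    _ = ∫⁻ ω, ∫⁻ t, F (Function.update (r ω) x t) ∂(P.map (v x)) ∂P :=
        lintegral_map hF'.lintegral_prod_right' hrm
    _ = _ := by simp only [hup]

/-! ### The alloy-type potential -/

section alloy

variable {d : ℕ} (Γ : AddSubgroup (Site d)) {a : Site d → ℝ} (ha : (Function.support a).Finite)

/-- The sites of `Γ` whose variables enter the potential at `n`. -/
noncomputable def alloySites (Γ : AddSubgroup (Site d)) {a : Site d → ℝ}
    (ha : (Function.support a).Finite) (n : Site d) : Finset Γ :=
  (ha.preimage (f := fun m : Γ => n - (m : Site d)) fun x _ y _ h => by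
    simpa using h).toFinset

@[simp] lemma mem_alloySites {n : Site d} {m : Γ} :
    m ∈ alloySites Γ ha n ↔ a (n - (m : Site d)) ≠ 0 := by
  simp [alloySites]

lemma card_alloySites_le (n : Site d) :
    (alloySites Γ ha n).card ≤ (Function.support a).ncard := by
  rw [Set.ncard_eq_toFinset_card _ ha]
  refine Finset.card_le_card_of_injOn (fun m => n - (m : Site d)) (fun m hm => ?_)
    (fun x _ y _ h => by simpa using h)
  simpa using hm

include ha in
lemma alloyPotential_eq_sum (v : Γ → ℝ) (n : Site d) :
    alloyPotential Γ a v n = ∑ m ∈ alloySites Γ ha n, a (n - (m : Site d)) * v m := by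
  refine finsum_eq_sum_of_support_subset _ fun m hm => ?_
  rw [Finset.mem_coe, mem_alloySites]
  exact left_ne_zero_of_mul hm

include ha in
lemma measurable_alloyPotential :
    Measurable fun v : Γ → ℝ => alloyPotential Γ a v := by
  refine measurable_pi_iff.2 fun n => ?_
  simp only [alloyPotential_eq_sum Γ ha]
  fun_prop

-- The potential is affine in each variable, with direction a(· - x) supported on as many sites as
-- a. This is the finite-rank perturbation to which Cramer's rule applies.
open Classical in
include ha in
lemma alloyPotential_update (v : Γ → ℝ) (x : Γ) (t : ℝ) (n : Site d) :
    alloyPotential Γ a (Function.update v x t) n =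
      alloyPotential Γ a (Function.update v x 0) n + t * a (n - (x : Site d)) := by
  rw [alloyPotential_eq_sum Γ ha, alloyPotential_eq_sum Γ ha]
  have h : ∀ m : Γ, a (n - (m : Site d)) * Function.update v x t m =
      a (n - (m : Site d)) * Function.update v x 0 m +
        if m = x then t * a (n - (x : Site d)) else 0 := by
    intro m
    by_cases hm : m = x
    · subst hm; simp [mul_comm]
    · simp [hm]
  simp only [h, Finset.sum_add_distrib, Finset.sum_ite_eq']
  congr 1
  split_ifs with hx
  · rfl
  · rw [mem_alloySites, not_not] at hx
    rw [hx, mul_zero]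

end alloy

/-! ### The random model -/

/-- The standing assumptions on the lattice, the single-site coefficients, the hopping kernel and
the random variables. -/
structure IsAlloySetup {d : ℕ} {Ω : Type*} {mΩ : MeasurableSpace Ω} (α q cA1 cA2 cK ca : ℝ) (k : ℕ)
    (Γ : AddSubgroup (Site d)) (a : Site d → ℝ) (K : Site d → Site d → ℂ) (P : Measure Ω)
    (v : Γ → Ω → ℝ) (μ : Measure ℝ) : Prop where
  prob : IsProbabilityMeasure P
  finite : (Function.support a).Finite
  card : (Function.support a).ncard = k
  bound : ∀ x, a x ≠ 0 → |a x| ≤ ca ∧ |a x|⁻¹ ≤ ca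
  cover : ∀ n : Site d, ∃ m ∈ Γ, a (n - m) ≠ 0
  hopping : IsHopping K cK
  meas : ∀ m, Measurable (v m)
  indep : iIndepFun v P
  law : ∀ m, P.map (v m) = μ
  regular : IsRegularMeasure μ α cA1
  moment : HasMomentBound μ q cA2

namespace IsAlloySetup

variable {d : ℕ} {Ω : Type*} {mΩ : MeasurableSpace Ω} {α q cA1 cA2 cK ca : ℝ} {k : ℕ}
  {Γ : AddSubgroup (Site d)} {a : Site d → ℝ} {K : Site d → Site d → ℂ} {P : Measure Ω}
  {v : Γ → Ω → ℝ} {μ : Measure ℝ}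

lemma isProbabilityMeasure (h : IsAlloySetup α q cA1 cA2 cK ca k Γ a K P v μ) :
    IsProbabilityMeasure μ := by
  have := h.prob
  rw [← h.law 0]
  exact Measure.isProbabilityMeasure_map (h.meas 0).aemeasurable

lemma ca_pos (h : IsAlloySetup α q cA1 cA2 cK ca k Γ a K P v μ) : 0 < ca := by
  obtain ⟨m, -, hm⟩ := h.cover 0
  exact (abs_pos.2 hm).trans_le (h.bound _ hm).1

lemma measurable_green_comp (h : IsAlloySetup α q cA1 cA2 cK ca k Γ a K P v μ) (g : ℝ) {z : ℂ}
    (hz : z.im ≠ 0) (m n : Site d) :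
    Measurable fun u : Γ → ℝ => green (alloyPotential Γ a u) K g z m n :=
  (continuous_green h.hopping g hz m n).measurable.comp (measurable_alloyPotential Γ h.finite)

lemma measurable_vec (h : IsAlloySetup α q cA1 cA2 cK ca k Γ a K P v μ) :
    Measurable fun ω (y : Γ) => v y ω := measurable_pi_iff.2 h.meas

lemma measurable_green (h : IsAlloySetup α q cA1 cA2 cK ca k Γ a K P v μ) (g : ℝ) {z : ℂ}
    (hz : z.im ≠ 0) (m n : Site d) :
    Measurable fun ω => green (alloyPotential Γ a fun y => v y ω) K g z m n :=
  (h.measurable_green_comp g hz m n).comp h.measurable_vec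

/-- A weight in one of the variables is absorbed by the potential. -/
lemma lintegral_weight_le (h : IsAlloySetup α q cA1 cA2 cK ca k Γ a K P v μ) {s : ℝ} (hs : 0 < s)
    {C : ℝ≥0} (hC : ∀ P Q : Polynomial ℂ, P.natDegree ≤ k → Q.natDegree ≤ k →
      (∀ t : ℝ, Q.eval (t : ℂ) ≠ 0) → ∀ b : ℝ,
      ∫⁻ t, ENNReal.ofReal ((1 + |t|) ^ s * ‖P.eval (t : ℂ) / Q.eval (t : ℂ)‖ ^ s) ∂μ ≤
        C * ∫⁻ t, ENNReal.ofReal (|t + b| ^ s * ‖P.eval (t : ℂ) / Q.eval (t : ℂ)‖ ^ s) ∂μ)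
    (lam g : ℝ) {z : ℂ} (hz : z.im ≠ 0) (m n : Site d) {x : Γ} (hx : a (m - x) ≠ 0) :
    ∫⁻ ω, ENNReal.ofReal ((1 + |v x ω|) ^ s *
        ‖green (alloyPotential Γ a fun y => v y ω) K g z m n‖ ^ s) ∂P ≤
      C * ENNReal.ofReal (ca ^ s) * ∫⁻ ω, ENNReal.ofReal
        (|alloyPotential Γ a (fun y => v y ω) m - lam| ^ s *
        ‖green (alloyPotential Γ a fun y => v y ω) K g z m n‖ ^ s) ∂P := by
  classical
  have := h.prob
  have hca := h.ca_pos
  have hGm := h.measurable_green_comp g hz m n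
  have hVm : Measurable fun u : Γ → ℝ => alloyPotential Γ a u m :=
    (measurable_pi_apply m).comp (measurable_alloyPotential Γ h.finite)
  rw [lintegral_eq_lintegral_update h.meas h.indep x (F := fun u => ENNReal.ofReal
      ((1 + |u x|) ^ s * ‖green (alloyPotential Γ a u) K g z m n‖ ^ s)) (by fun_prop),
    lintegral_eq_lintegral_update h.meas h.indep x (F := fun u => ENNReal.ofReal
      (|alloyPotential Γ a u m - lam| ^ s * ‖green (alloyPotential Γ a u) K g z m n‖ ^ s))
      (by fun_prop), h.law x, ← lintegral_const_mul' _ _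
      (ENNReal.mul_ne_top ENNReal.coe_ne_top ENNReal.ofReal_ne_top)]
  refine lintegral_mono fun ω => ?_
  set W := alloyPotential Γ a (Function.update (fun y => v y ω) x 0) with hW
  set D : Site d → ℝ := fun y => a (y - (x : Site d)) with hD
  have hup : ∀ t, alloyPotential Γ a (Function.update (fun y => v y ω) x t) =
      fun y => W y + t * D y := fun t => funext fun y =>
    alloyPotential_update Γ h.finite _ x t y
  set S : Finset (Site d) := h.finite.toFinset.map (addRightEmbedding (x : Site d)) with hS
  have hScard : S.card = k := by
    rw [hS, Finset.card_map, ← Set.ncard_eq_toFinset_card _ h.finite, h.card]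
  have hSD : ∀ y, D y ≠ 0 → y ∈ S := by
    intro y hy
    rw [hS, Finset.mem_map]
    exact ⟨y - x, by simpa using hy, by simp⟩
  obtain ⟨Pp, Qp, hP, hQ, hQ0, hPQ⟩ := exists_green_eq_div W h.hopping g hz D S hSD m n
  -- The shift b is chosen so that V(m) - λ = D(m)(t + b); dividing by D(m) costs at most the factor
  -- ca.
  have hmain := hC Pp Qp (hScard ▸ hP) (hScard ▸ hQ) hQ0 ((W m - lam) / D m)
  simp only [hup, hPQ, Function.update_self]
  refine hmain.trans ?_
  rw [mul_assoc, ← lintegral_const_mul' _ _ ENNReal.ofReal_ne_top]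
  gcongr with t
  rw [← ENNReal.ofReal_mul (by positivity)]
  refine ENNReal.ofReal_le_ofReal ?_
  rw [← mul_assoc, ← Real.mul_rpow hca.le (abs_nonneg _)]
  refine mul_le_mul_of_nonneg_right (Real.rpow_le_rpow (abs_nonneg _) ?_ hs.le) (by positivity)
  have hDm : D m ≠ 0 := hx
  have e : t + (W m - lam) / D m = (D m)⁻¹ * (W m + t * D m - lam) := by field_simp; ring
  rw [e, abs_mul, abs_inv]
  exact mul_le_mul_of_nonneg_right (h.bound _ hx).2 (abs_nonneg _)

/-- Either the potential is far from λ, or it is of order λ and then some variable entering it is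
large. The summand 1 is absorbed because, by the covering condition, at least one variable enters
V(m). -/
lemma one_add_abs_rpow_le (h : IsAlloySetup α q cA1 cA2 cK ca k Γ a K P v μ) {s : ℝ} (hs : 0 < s)
    (hs1 : s ≤ 1) (lam : ℝ) (m : Site d) (u : Γ → ℝ) :
    (1 + |lam|) ^ s ≤ |alloyPotential Γ a u m - lam| ^ s +
      ∑ x ∈ alloySites Γ h.finite m, (1 + ca) ^ s * (1 + |u x|) ^ s := by
  have hca := h.ca_pos
  set J := alloySites Γ h.finite m with hJ
  set V := alloyPotential Γ a u m with hV
  have hJne : J.Nonempty := by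
    obtain ⟨x, hx, hax⟩ := h.cover m
    exact ⟨⟨x, hx⟩, (mem_alloySites Γ h.finite).2 hax⟩
  have h1 : |V| ≤ ∑ x ∈ J, ca * |u x| := by
    rw [hV, alloyPotential_eq_sum Γ h.finite]
    refine (Finset.abs_sum_le_sum_abs _ _).trans (Finset.sum_le_sum fun x hx => ?_)
    rw [abs_mul]
    exact mul_le_mul_of_nonneg_right (h.bound _ ((mem_alloySites Γ h.finite).1 hx)).1
      (abs_nonneg _)
  have h2 : (1 : ℝ) + ∑ x ∈ J, ca * |u x| ≤ ∑ x ∈ J, (1 + ca) * (1 + |u x|) := by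
    have : (1 : ℝ) ≤ ∑ _x ∈ J, (1 : ℝ) := by
      rw [Finset.sum_const, nsmul_eq_mul, mul_one]
      exact_mod_cast hJne.card_pos
    refine (add_le_add_left this _).trans ?_
    rw [← Finset.sum_add_distrib]
    refine Finset.sum_le_sum fun x _ => ?_
    nlinarith [abs_nonneg (u x), hca]
  have h3 : |lam| ≤ |V - lam| + |V| := by
    have := abs_sub V (V - lam)
    rw [sub_sub_cancel] at this
    linarith
  have hsum : ∀ J : Finset Γ, (∑ x ∈ J, (1 + ca) * (1 + |u x|)) ^ s ≤
      ∑ x ∈ J, (1 + ca) ^ s * (1 + |u x|) ^ s := by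
    intro J
    classical
    induction J using Finset.induction_on with
    | empty => simp [hs.ne']
    | insert x J hx ih =>
      rw [Finset.sum_insert hx, Finset.sum_insert hx, ← Real.mul_rpow (by positivity)
        (by positivity)]
      exact (Real.rpow_add_le_add_rpow (by positivity) (Finset.sum_nonneg fun _ _ => by positivity)
        hs.le hs1).trans (add_le_add_right ih _)
  calc (1 + |lam|) ^ s ≤ (|V - lam| + ∑ x ∈ J, (1 + ca) * (1 + |u x|)) ^ s :=
        Real.rpow_le_rpow (by positivity) (by linarith) hs.le
    _ ≤ |V - lam| ^ s + (∑ x ∈ J, (1 + ca) * (1 + |u x|)) ^ s :=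
        Real.rpow_add_le_add_rpow (abs_nonneg _) (Finset.sum_nonneg fun _ _ => by positivity)
          hs.le hs1
    _ ≤ _ := add_le_add_right (hsum J) _

/-- The decoupling inequality for the Green function. -/
lemma lintegral_green_decoupling (h : IsAlloySetup α q cA1 cA2 cK ca k Γ a K P v μ) {s : ℝ}
    (hs : 0 < s) (hs1 : s ≤ 1) {C : ℝ≥0}
    (hC : ∀ P Q : Polynomial ℂ, P.natDegree ≤ k → Q.natDegree ≤ k →
      (∀ t : ℝ, Q.eval (t : ℂ) ≠ 0) → ∀ b : ℝ,
      ∫⁻ t, ENNReal.ofReal ((1 + |t|) ^ s * ‖P.eval (t : ℂ) / Q.eval (t : ℂ)‖ ^ s) ∂μ ≤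
        C * ∫⁻ t, ENNReal.ofReal (|t + b| ^ s * ‖P.eval (t : ℂ) / Q.eval (t : ℂ)‖ ^ s) ∂μ)
    (lam g : ℝ) {z : ℂ} (hz : z.im ≠ 0) (m n : Site d) :
    ENNReal.ofReal ((1 + |lam|) ^ s) *
        ∫⁻ ω, ENNReal.ofReal (‖green (alloyPotential Γ a fun y => v y ω) K g z m n‖ ^ s) ∂P ≤
      ENNReal.ofReal (1 + k * (1 + ca) ^ s * (C * ca ^ s)) * ∫⁻ ω, ENNReal.ofReal
        (|alloyPotential Γ a (fun y => v y ω) m - lam| ^ s *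
        ‖green (alloyPotential Γ a fun y => v y ω) K g z m n‖ ^ s) ∂P := by
  have hca := h.ca_pos
  have hGm := h.measurable_green g hz m n
  have hVm : Measurable fun ω => alloyPotential Γ a (fun y => v y ω) m :=
    (measurable_pi_apply m).comp ((measurable_alloyPotential Γ h.finite).comp h.measurable_vec)
  have hvm := h.meas
  set J := alloySites Γ h.finite m with hJ
  set I := ∫⁻ ω, ENNReal.ofReal (|alloyPotential Γ a (fun y => v y ω) m - lam| ^ s *
        ‖green (alloyPotential Γ a fun y => v y ω) K g z m n‖ ^ s) ∂P with hI
  have hcard : (J.card : ℝ≥0∞) ≤ k := by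
    have := card_alloySites_le Γ h.finite m
    rw [h.card] at this
    exact_mod_cast this
  rw [← lintegral_const_mul _ (by fun_prop)]
  calc ∫⁻ ω, ENNReal.ofReal ((1 + |lam|) ^ s) *
        ENNReal.ofReal (‖green (alloyPotential Γ a fun y => v y ω) K g z m n‖ ^ s) ∂P
      ≤ ∫⁻ ω, (ENNReal.ofReal (|alloyPotential Γ a (fun y => v y ω) m - lam| ^ s *
          ‖green (alloyPotential Γ a fun y => v y ω) K g z m n‖ ^ s) +
          ∑ x ∈ J, ENNReal.ofReal ((1 + ca) ^ s) * ENNReal.ofReal ((1 + |v x ω|) ^ s *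
          ‖green (alloyPotential Γ a fun y => v y ω) K g z m n‖ ^ s)) ∂P := by
        refine lintegral_mono fun ω => ?_
        have e : ∀ x ∈ J, ENNReal.ofReal ((1 + ca) ^ s) * ENNReal.ofReal ((1 + |v x ω|) ^ s *
          ‖green (alloyPotential Γ a fun y => v y ω) K g z m n‖ ^ s) =
          ENNReal.ofReal ((1 + ca) ^ s * (1 + |v x ω|) ^ s *
          ‖green (alloyPotential Γ a fun y => v y ω) K g z m n‖ ^ s) := fun x _ => by
          rw [← ENNReal.ofReal_mul (by positivity), mul_assoc]
        rw [Finset.sum_congr rfl e, ← ENNReal.ofReal_sum_of_nonneg (fun x _ => by positivity),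
          ← ENNReal.ofReal_add (by positivity) (Finset.sum_nonneg fun _ _ => by positivity),
          ← ENNReal.ofReal_mul (by positivity), ← Finset.sum_mul, ← add_mul]
        exact ENNReal.ofReal_le_ofReal (mul_le_mul_of_nonneg_right
          (h.one_add_abs_rpow_le hs hs1 lam m _) (by positivity))
    _ = I + ∑ x ∈ J, ENNReal.ofReal ((1 + ca) ^ s) * ∫⁻ ω, ENNReal.ofReal ((1 + |v x ω|) ^ s *
          ‖green (alloyPotential Γ a fun y => v y ω) K g z m n‖ ^ s) ∂P := by
        rw [lintegral_add_left (by fun_prop), lintegral_finsetSum _ fun x _ => by fun_prop]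
        congr 1
        exact Finset.sum_congr rfl fun x _ => lintegral_const_mul _ (by fun_prop)
    _ ≤ I + ∑ _x ∈ J, ENNReal.ofReal ((1 + ca) ^ s) * (C * ENNReal.ofReal (ca ^ s) * I) := by
        gcongr with x hx
        exact h.lintegral_weight_le hs hC lam g hz m n ((mem_alloySites Γ h.finite).1 hx)
    _ ≤ I + k * (ENNReal.ofReal ((1 + ca) ^ s) * (C * ENNReal.ofReal (ca ^ s) * I)) := by
        rw [Finset.sum_const, nsmul_eq_mul]
        gcongr
    _ = _ := by
        rw [ENNReal.ofReal_add (by positivity) (by positivity), ENNReal.ofReal_mul (by positivity),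
          ENNReal.ofReal_mul (by positivity), ENNReal.ofReal_mul (by positivity),
          ENNReal.ofReal_natCast, ENNReal.ofReal_one, ENNReal.ofReal_coe_nnreal]
        ring

end IsAlloySetup

/-! ### Exponential decay from a subharmonicity inequality -/

lemma latticeDist_triangle {d : ℕ} (x y z : Site d) :
    latticeDist x z ≤ latticeDist x y + latticeDist y z := by
  unfold latticeDist
  rw [← Finset.sum_add_distrib]
  exact Finset.sum_le_sum fun i _ => by omega

lemma latticeDist_comm {d : ℕ} (x y : Site d) : latticeDist x y = latticeDist y x := by
  unfold latticeDist
  exact Finset.sum_congr rfl fun i _ => by omega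

@[simp] lemma latticeDist_self {d : ℕ} (x : Site d) : latticeDist x x = 0 := by
  simp [latticeDist]

/-- Off n, the inequality bounds F by τ = 2dκ times its supremum over neighbours. Boundedness of F
is needed to start the iteration, but M does not enter the conclusion. -/
lemma le_two_mul_pow_of_subharmonic {d : ℕ} (n : Site d) {F : Site d → ℝ} {M B κ : ℝ}
    (hB : 0 ≤ B) (hκ : 0 ≤ κ) (hM : ∀ m, F m ≤ M) (hτ : 2 * d * κ ≤ 1 / 2)
    (hF : ∀ m, F m ≤ B * (if m = n then 1 else 0) +
      κ * ∑ i : Fin d, (F (m + unitVec i) + F (m - unitVec i))) (m : Site d) :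
    F m ≤ 2 * B * (2 * d * κ) ^ latticeDist m n := by
  set τ := 2 * d * κ with hτdef
  have hτ0 : 0 ≤ τ := by positivity
  have hstep : ∀ (m : Site d) (X : ℝ), (∀ i, F (m + unitVec i) ≤ X) → (∀ i, F (m - unitVec i) ≤ X) →
      κ * ∑ i : Fin d, (F (m + unitVec i) + F (m - unitVec i)) ≤ τ * X := by
    intro m X h1 h2
    calc κ * ∑ i : Fin d, (F (m + unitVec i) + F (m - unitVec i))
        ≤ κ * ∑ _i : Fin d, (X + X) := by
          gcongr with i
          · exact h1 i
          · exact h2 i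
      _ = τ * X := by simp [hτdef]; ring
  -- The value 2B reproduces itself, since B + τ·2B ≤ 2B for τ ≤ 1/2, while the a priori bound is
  -- damped by τ at each step.
  have hiter : ∀ (N : ℕ) (m : Site d), F m ≤ 2 * B + τ ^ N * |M| := by
    intro N
    induction N with
    | zero => intro m; rw [pow_zero, one_mul]; linarith [hM m, le_abs_self M]
    | succ N ih =>
      intro m
      have h1 := hstep m _ (fun i => ih _) (fun i => ih _)
      have h2 : B * (if m = n then (1 : ℝ) else 0) ≤ B := by split_ifs <;> simp [hB]
      have h3 : τ * (2 * B) ≤ 1 / 2 * (2 * B) := by gcongr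
      calc F m ≤ _ := hF m
        _ ≤ B + τ * (2 * B + τ ^ N * |M|) := add_le_add h2 h1
        _ ≤ 2 * B + τ ^ (N + 1) * |M| := by rw [pow_succ]; nlinarith
  have hsup : ∀ m, F m ≤ 2 * B := by
    intro m
    have hlim : Tendsto (fun N : ℕ => 2 * B + τ ^ N * |M|) atTop (𝓝 (2 * B + 0 * |M|)) :=
      ((tendsto_pow_atTop_nhds_zero_of_lt_one hτ0 (by linarith)).mul_const _).const_add _
    have := ge_of_tendsto' hlim fun N => hiter N m
    linarith
  -- Neighbours of a site at distance at least r+1 from n are at distance at least r, so each unit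
  -- of distance gains one factor τ.
  have hdecay : ∀ (r : ℕ) (m : Site d), r ≤ latticeDist m n → F m ≤ 2 * B * τ ^ r := by
    intro r
    induction r with
    | zero => intro m _; simpa using hsup m
    | succ r ih =>
      intro m hm
      have hne : m ≠ n := by rintro rfl; simp at hm
      have hplus : ∀ i, r ≤ latticeDist (m + unitVec i) n := by
        intro i
        have := latticeDist_triangle m (m + unitVec i) n
        rw [latticeDist_add_unitVec] at this
        omega
      have hminus : ∀ i, r ≤ latticeDist (m - unitVec i) n := by
        intro i
        have := latticeDist_triangle m (m - unitVec i) n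
        rw [latticeDist_comm m (m - unitVec i), latticeDist_sub_unitVec] at this
        omega
      have h1 := hstep m _ (fun i => ih _ (hplus i)) (fun i => ih _ (hminus i))
      have h2 := hF m
      rw [if_neg hne, mul_zero, zero_add] at h2
      calc F m ≤ _ := h2.trans h1
        _ = _ := by rw [pow_succ]; ring
  exact hdecay _ m le_rfl

/-! ### Fractional moments of the Green function off the real axis. -/

lemma IsHopping.norm_add_le {d : ℕ} {K : Site d → Site d → ℂ} {c : ℝ} (hK : IsHopping K c)
    (m : Site d) (i : Fin d) : ‖K m (m + unitVec i)‖ ≤ c :=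
  (hK _ _ (latticeDist_add_unitVec m i)).2

lemma IsHopping.norm_sub_le {d : ℕ} {K : Site d → Site d → ℂ} {c : ℝ} (hK : IsHopping K c)
    (m : Site d) (i : Fin d) : ‖K m (m - unitVec i)‖ ≤ c := by
  have := hK _ _ (latticeDist_sub_unitVec m i)
  rw [this.1, RCLike.norm_conj]
  exact this.2

/-- The fractional-power form of the equation for the Green function. -/
lemma rpow_green_le {d : ℕ} (V : Site d → ℝ) {K : Site d → Site d → ℂ} {c : ℝ}
    (hK : IsHopping K c) {g : ℝ} (hg : 0 < g) {z : ℂ} (hz : z.im ≠ 0) {s : ℝ} (hs : 0 < s)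
    (hs1 : s ≤ 1) (m n : Site d) :
    |V m - z.re| ^ s * ‖green V K g z m n‖ ^ s ≤ (if m = n then 1 else 0) +
      (g⁻¹ * |c|) ^ s * ∑ i : Fin d, (‖green V K g z (m + unitVec i) n‖ ^ s +
        ‖green V K g z (m - unitVec i) n‖ ^ s) := by
  set G : Site d → ℂ := fun x => green V K g z x n with hG
  set b := g⁻¹ * |c| with hb
  have hb0 : 0 ≤ b := by positivity
  have h1 : |V m - z.re| ≤ ‖(V m : ℂ) - z‖ := by
    have := Complex.abs_re_le_norm ((V m : ℂ) - z)
    simpa using this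
  have h2 : ((V m : ℂ) - z) * G m = (if m = n then 1 else 0) - ((g⁻¹ : ℝ) : ℂ) * hop K G m :=
    eq_sub_of_add_eq (green_equation V hK g hz m n)
  have h3 : ‖((g⁻¹ : ℝ) : ℂ) * hop K G m‖ ≤
      ∑ i : Fin d, (b * ‖G (m + unitVec i)‖ + b * ‖G (m - unitVec i)‖) := by
    rw [norm_mul, Complex.norm_real, Real.norm_eq_abs, abs_of_pos (inv_pos.2 hg), hop]
    refine (mul_le_mul_of_nonneg_left (norm_sum_le _ _) (inv_nonneg.2 hg.le)).trans ?_
    rw [Finset.mul_sum]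
    refine Finset.sum_le_sum fun i _ => ?_
    rw [hb, mul_assoc, mul_assoc, ← mul_add]
    refine mul_le_mul_of_nonneg_left ((norm_add_le _ _).trans (add_le_add ?_ ?_))
      (inv_nonneg.2 hg.le)
    · rw [norm_mul]
      exact mul_le_mul_of_nonneg_right ((hK.norm_add_le m i).trans (le_abs_self c)) (norm_nonneg _)
    · rw [norm_mul]
      exact mul_le_mul_of_nonneg_right ((hK.norm_sub_le m i).trans (le_abs_self c)) (norm_nonneg _)
  have hsum : ∀ T : Finset (Fin d), (∑ i ∈ T, (b * ‖G (m + unitVec i)‖ + b * ‖G (m - unitVec i)‖)) ^ s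
      ≤ ∑ i ∈ T, b ^ s * (‖G (m + unitVec i)‖ ^ s + ‖G (m - unitVec i)‖ ^ s) := by
    intro T
    induction T using Finset.induction_on with
    | empty => simp [hs.ne']
    | insert x T hx ih =>
      rw [Finset.sum_insert hx, Finset.sum_insert hx]
      refine (Real.rpow_add_le_add_rpow (by positivity)
        (Finset.sum_nonneg fun _ _ => by positivity) hs.le hs1).trans (add_le_add ?_ ih)
      rw [mul_add, ← Real.mul_rpow hb0 (norm_nonneg _), ← Real.mul_rpow hb0 (norm_nonneg _)]
      exact Real.rpow_add_le_add_rpow (by positivity) (by positivity) hs.le hs1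
  set e : ℝ := if m = n then 1 else 0 with he
  have he0 : 0 ≤ e := by rw [he]; split_ifs <;> norm_num
  have hes : e ^ s = e := by
    rw [he]
    split_ifs
    · exact Real.one_rpow s
    · exact Real.zero_rpow hs.ne'
  rw [← Real.mul_rpow (abs_nonneg _) (norm_nonneg _), Finset.mul_sum]
  calc (|V m - z.re| * ‖G m‖) ^ s
      ≤ (e + ∑ i : Fin d, (b * ‖G (m + unitVec i)‖ + b * ‖G (m - unitVec i)‖)) ^ s := by
        refine Real.rpow_le_rpow (by positivity) ?_ hs.le
        calc |V m - z.re| * ‖G m‖ ≤ ‖(V m : ℂ) - z‖ * ‖G m‖ := by gcongr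
          _ = ‖((V m : ℂ) - z) * G m‖ := (norm_mul _ _).symm
          _ ≤ ‖(if m = n then 1 else 0 : ℂ)‖ + ‖((g⁻¹ : ℝ) : ℂ) * hop K G m‖ := by
              rw [h2]; exact norm_sub_le _ _
          _ ≤ _ := by
              refine add_le_add ?_ h3
              rw [he]
              split_ifs <;> simp
    _ ≤ e ^ s + (∑ i : Fin d, (b * ‖G (m + unitVec i)‖ + b * ‖G (m - unitVec i)‖)) ^ s :=
        Real.rpow_add_le_add_rpow he0 (Finset.sum_nonneg fun _ _ => by positivity) hs.le hs1
    _ ≤ _ := add_le_add hes.le (hsum _)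

/-- The uniform fractional-moment bound away from the real axis, given decoupling. -/
lemma IsAlloySetup.lintegral_green_le {d : ℕ} {Ω : Type*} {mΩ : MeasurableSpace Ω}
    {α q cA1 cA2 cK ca : ℝ} {k : ℕ} {Γ : AddSubgroup (Site d)} {a : Site d → ℝ}
    {K : Site d → Site d → ℂ} {P : Measure Ω} {v : Γ → Ω → ℝ} {μ : Measure ℝ}
    (h : IsAlloySetup α q cA1 cA2 cK ca k Γ a K P v μ) {s : ℝ}
    (hs : 0 < s) (hs1 : s ≤ 1) {A : ℝ} (hA : 0 ≤ A) {g : ℝ} (hg : 0 < g) {z : ℂ} (hz : z.im ≠ 0)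
    (hdec : ∀ m n : Site d, ENNReal.ofReal ((1 + |z.re|) ^ s) *
        ∫⁻ ω, ENNReal.ofReal (‖green (alloyPotential Γ a fun y => v y ω) K g z m n‖ ^ s) ∂P ≤
      ENNReal.ofReal A * ∫⁻ ω, ENNReal.ofReal
        (|alloyPotential Γ a (fun y => v y ω) m - z.re| ^ s *
        ‖green (alloyPotential Γ a fun y => v y ω) K g z m n‖ ^ s) ∂P)
    (hτ : 2 * d * (A / (1 + |z.re|) ^ s * (g⁻¹ * |cK|) ^ s) ≤ 1 / 2) (m n : Site d) :
    ∫⁻ ω, ENNReal.ofReal (‖green (alloyPotential Γ a fun y => v y ω) K g z m n‖ ^ s) ∂P ≤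
      ENNReal.ofReal (2 * (A / (1 + |z.re|) ^ s) *
        (2 * d * (A / (1 + |z.re|) ^ s * (g⁻¹ * |cK|) ^ s)) ^ latticeDist m n) := by
  have := h.prob
  have hL : 0 < (1 + |z.re|) ^ s := by positivity
  set I : Site d → ℝ≥0∞ := fun m =>
    ∫⁻ ω, ENNReal.ofReal (‖green (alloyPotential Γ a fun y => v y ω) K g z m n‖ ^ s) ∂P with hI
  -- This bound blows up at the real axis; it serves only to make the moments finite and the
  -- iteration legitimate.
  have hIM : ∀ m, I m ≤ ENNReal.ofReal ((|z.im|⁻¹) ^ s) := by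
    intro m
    refine (lintegral_mono fun ω => ENNReal.ofReal_le_ofReal (Real.rpow_le_rpow (norm_nonneg _)
      (norm_green_le _ h.hopping g hz m n) hs.le)).trans ?_
    simp
  have hItop : ∀ m, I m ≠ ∞ := fun m => ((hIM m).trans_lt ENNReal.ofReal_lt_top).ne
  have hGm := fun m => h.measurable_green g hz m n
  have hIle : ∀ m, I m ≤ ENNReal.ofReal (A / (1 + |z.re|) ^ s) *
      (ENNReal.ofReal (if m = n then 1 else 0) + ENNReal.ofReal ((g⁻¹ * |cK|) ^ s) *
        ∑ i : Fin d, (I (m + unitVec i) + I (m - unitVec i))) := by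
    intro m
    have h1 : ∫⁻ ω, ENNReal.ofReal (|alloyPotential Γ a (fun y => v y ω) m - z.re| ^ s *
        ‖green (alloyPotential Γ a fun y => v y ω) K g z m n‖ ^ s) ∂P ≤
        ENNReal.ofReal (if m = n then 1 else 0) + ENNReal.ofReal ((g⁻¹ * |cK|) ^ s) *
        ∑ i : Fin d, (I (m + unitVec i) + I (m - unitVec i)) := by
      have e : ∀ i : Fin d, I (m + unitVec i) + I (m - unitVec i) =
          ∫⁻ ω, (ENNReal.ofReal (‖green (alloyPotential Γ a fun y => v y ω) K g z
            (m + unitVec i) n‖ ^ s) + ENNReal.ofReal (‖green (alloyPotential Γ a fun y => v y ω)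
            K g z (m - unitVec i) n‖ ^ s)) ∂P := fun i =>
        (lintegral_add_left (by have := hGm (m + unitVec i); fun_prop) _).symm
      have hm1 : ∀ i : Fin d, Measurable fun ω => (ENNReal.ofReal (‖green (alloyPotential Γ a
          fun y => v y ω) K g z (m + unitVec i) n‖ ^ s) + ENNReal.ofReal
          (‖green (alloyPotential Γ a fun y => v y ω) K g z (m - unitVec i) n‖ ^ s)) := fun i => by
        have h1 := hGm (m + unitVec i)
        have h2 := hGm (m - unitVec i)
        fun_prop
      rw [Finset.sum_congr rfl fun i _ => e i, ← lintegral_finsetSum _ fun i _ => hm1 i,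
        ← lintegral_const_mul _ (Finset.univ.measurable_fun_sum fun i _ => hm1 i)]
      have hconst : ∀ x : ℝ≥0∞, x = ∫⁻ _ω, x ∂P := fun x => by simp
      rw [hconst (ENNReal.ofReal (if m = n then 1 else 0)), ← lintegral_add_left measurable_const]
      refine lintegral_mono fun ω => ?_
      refine (ENNReal.ofReal_le_ofReal (rpow_green_le _ h.hopping hg hz hs hs1 m n)).trans
        (le_of_eq ?_)
      rw [ENNReal.ofReal_add (by split_ifs <;> norm_num) (by positivity),
        ENNReal.ofReal_mul (by positivity), ENNReal.ofReal_sum_of_nonneg fun i _ => by positivity]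
      congr 2
      exact Finset.sum_congr rfl fun i _ => ENNReal.ofReal_add (by positivity) (by positivity)
    have h2 := (hdec m n).trans (mul_le_mul_right h1 (ENNReal.ofReal A))
    rw [ENNReal.ofReal_div_of_pos hL, ENNReal.mul_comm_div, ← mul_div_assoc,
      ENNReal.le_div_iff_mul_le (Or.inl (by simpa using hL)) (Or.inl ENNReal.ofReal_ne_top),
      mul_comm]
    exact h2
  have hreal : ∀ m, (I m).toReal ≤ A / (1 + |z.re|) ^ s * (if m = n then 1 else 0) +
      (A / (1 + |z.re|) ^ s * (g⁻¹ * |cK|) ^ s) *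
        ∑ i : Fin d, ((I (m + unitVec i)).toReal + (I (m - unitVec i)).toReal) := by
    intro m
    refine ENNReal.toReal_le_of_le_ofReal (by positivity) ((hIle m).trans (le_of_eq ?_))
    rw [mul_add, ENNReal.ofReal_add (by positivity) (by positivity),
      ENNReal.ofReal_mul (by positivity), mul_assoc, ENNReal.ofReal_mul (by positivity),
      ENNReal.ofReal_mul (by positivity), ENNReal.ofReal_sum_of_nonneg fun i _ => by positivity]
    congr 3
    refine Finset.sum_congr rfl fun i _ => ?_
    rw [ENNReal.ofReal_add ENNReal.toReal_nonneg ENNReal.toReal_nonneg,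
      ENNReal.ofReal_toReal (hItop _), ENNReal.ofReal_toReal (hItop _)]
  have hfin := le_two_mul_pow_of_subharmonic n (F := fun m => (I m).toReal)
    (M := (|z.im|⁻¹) ^ s) (by positivity) (by positivity)
    (fun m => ENNReal.toReal_le_of_le_ofReal (by positivity) (hIM m)) hτ hreal m
  refine (ENNReal.ofReal_toReal (hItop m)).symm.le.trans ?_
  exact ENNReal.ofReal_le_ofReal hfin

lemma pos_of_lt_exponent {α q s : ℝ} {k : ℕ} (hs : 0 < s)
    (hs' : s < α * q / (2 * (k : ℝ) * α + (k : ℝ) * q)) : 0 < k := by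
  rcases Nat.eq_zero_or_pos k with rfl | hk
  · simp at hs'; linarith
  · exact hk

/-- Since α ≤ 1 and k ≥ 1, the threshold is below αq/(kq) ≤ 1; subadditivity of x ↦ x^s is thus
always available. -/
lemma le_one_of_lt_exponent {α q s : ℝ} {k : ℕ} (hα : 0 < α) (hq : 0 < q) (hs : 0 < s)
    (hα1 : α ≤ 1) (hs' : s < α * q / (2 * (k : ℝ) * α + (k : ℝ) * q)) : s ≤ 1 := by
  have hk := pos_of_lt_exponent hs hs'
  have hk1 : (1 : ℝ) ≤ k := by exact_mod_cast hk
  have hs'' : s * (2 * k * α + k * q) < α * q := (lt_div_iff₀ (by positivity)).1 hs'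
  by_contra! h1
  have h2 : 1 * (k * q) < s * (k * q) := by gcongr
  have h3 : 1 * q ≤ k * q := by gcongr
  have h4 : 0 < s * (2 * k * α) := by positivity
  have h5 : α * q ≤ 1 * q := by gcongr
  nlinarith

universe u

/-- The fractional-moment bound, uniformly in the distance to the real axis. -/
theorem exists_uniform_lintegral_green_le {α q s : ℝ} (cA1 cA2 cK ca : ℝ) {k : ℕ} (hα : 0 < α)
    (hq : 0 < q) (hs : 0 < s) (hs' : s < α * q / (2 * (k : ℝ) * α + (k : ℝ) * q)) :
    ∃ C : ℝ, 0 < C ∧ ∀ {d : ℕ} (_ : 0 < d) {Ω : Type u} {_mΩ : MeasurableSpace Ω}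
      {Γ : AddSubgroup (Site d)} {a : Site d → ℝ}
      {K : Site d → Site d → ℂ} {P : Measure Ω} {v : Γ → Ω → ℝ} {μ : Measure ℝ}
      (_ : IsAlloySetup α q cA1 cA2 cK ca k Γ a K P v μ) {lam g : ℝ}
      (_ : C * (d : ℝ) ^ (1 / s) / (1 + |lam|) ≤ g),
      ∃ τ : ℝ, 0 ≤ τ ∧ τ ≤ 1 / 2 ∧ τ ≤ C * d / (g ^ s * (1 + |lam|) ^ s) ∧
        ∀ (z : ℂ), z.re = lam → z.im ≠ 0 → ∀ m n : Site d,
        ∫⁻ ω, ENNReal.ofReal (‖green (alloyPotential Γ a fun y => v y ω) K g z m n‖ ^ s) ∂P ≤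
          ENNReal.ofReal (C / (1 + |lam|) ^ s * τ ^ latticeDist m n) := by
  have hk := pos_of_lt_exponent hs hs'
  by_cases hα1 : α ≤ 1
  swap
  -- For α > 1 no probability measure is α-regular, so the claim is vacuous and any constant serves.
  · refine ⟨1, one_pos, fun _ _ _ _ _ _ _ _ _ h _ _ _ => ?_⟩
    have := h.isProbabilityMeasure
    exact absurd h.regular.le_one hα1
  have hs'' : s * (2 * k * α + k * q) < α * q := (lt_div_iff₀ (by positivity)).1 hs'
  have hs1 : s ≤ 1 := le_one_of_lt_exponent hα hq hs hα1 hs'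
  obtain ⟨C₀, hC₀⟩ := exists_polynomial_decoupling cA1 cA2 hα hq hs hs1 hk hs''
  set A : ℝ := 1 + k * (1 + |ca|) ^ s * (C₀ * |ca| ^ s) with hA
  have hA1 : 0 < A := by positivity
  -- The three summands serve the three requirements: the prefactor 2A, the bound τ ≤ C
  -- d/(g(1+|λ|))^s, and, through its s-th power, τ ≤ 1/2.
  set C : ℝ := 2 * A + 2 * A * |cK| ^ s + (4 * A * |cK| ^ s + 1) ^ (1 / s) with hC
  have hCpos : 0 < C := by positivity
  have hC1 : 2 * A ≤ C := by
    have : 0 ≤ 2 * A * |cK| ^ s + (4 * A * |cK| ^ s + 1) ^ (1 / s) := by positivity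
    linarith
  have hC2 : 2 * A * |cK| ^ s ≤ C := by
    have : 0 ≤ 2 * A + (4 * A * |cK| ^ s + 1) ^ (1 / s) := by positivity
    linarith
  have hC3 : 4 * A * |cK| ^ s ≤ C ^ s := by
    have h1 : (4 * A * |cK| ^ s + 1) ^ (1 / s) ≤ C := by
      have : 0 ≤ 2 * A + 2 * A * |cK| ^ s := by positivity
      linarith
    have h2 := Real.rpow_le_rpow (by positivity) h1 hs.le
    rw [← Real.rpow_mul (by positivity), one_div, inv_mul_cancel₀ hs.ne', Real.rpow_one] at h2
    linarith
  refine ⟨C, hCpos, fun {d} hd Ω mΩ Γ a K P v μ h lam g hg => ?_⟩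
  have hd' : (0 : ℝ) < d := by exact_mod_cast hd
  have hlam : 0 < 1 + |lam| := by positivity
  have hgpos : 0 < g := lt_of_lt_of_le (by positivity) hg
  have hgs : C ^ s * d ≤ g ^ s * (1 + |lam|) ^ s := by
    have h1 : C * (d : ℝ) ^ (1 / s) ≤ g * (1 + |lam|) := (div_le_iff₀ hlam).1 hg
    have h2 := Real.rpow_le_rpow (by positivity) h1 hs.le
    rwa [Real.mul_rpow hCpos.le (by positivity), ← Real.rpow_mul hd'.le, one_div,
      inv_mul_cancel₀ hs.ne', Real.rpow_one, Real.mul_rpow hgpos.le hlam.le] at h2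
  have hgsp : 0 < g ^ s * (1 + |lam|) ^ s := by positivity
  set τ : ℝ := 2 * d * (A / (1 + |lam|) ^ s * (g⁻¹ * |cK|) ^ s) with hτ
  have hτeq : τ = 2 * A * |cK| ^ s * d / (g ^ s * (1 + |lam|) ^ s) := by
    rw [hτ, Real.mul_rpow (by positivity) (by positivity), Real.inv_rpow hgpos.le]
    have : 0 < g ^ s := by positivity
    field_simp
  have hτhalf : τ ≤ 1 / 2 := by
    rw [hτeq, div_le_iff₀ hgsp]
    have : 4 * A * |cK| ^ s * d ≤ C ^ s * d := by gcongr
    linarith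
  have hμ := h.isProbabilityMeasure
  refine ⟨τ, by positivity, hτhalf, ?_, ?_⟩
  · rw [hτeq]
    gcongr
  · rintro z rfl hz m n
    refine (h.lintegral_green_le hs hs1 hA1.le hgpos hz (fun m n => ?_) hτhalf m n).trans ?_
    · have := h.lintegral_green_decoupling hs hs1 (hC₀ μ hμ h.regular h.moment) z.re g hz m n
      rwa [hA, abs_of_pos h.ca_pos]
    · refine ENNReal.ofReal_le_ofReal ?_
      rw [mul_div_assoc']
      gcongr

/-! ### Comparison of nearby resolvents -/

lemma enorm_le_tsum_enorm {d : ℕ} (ψ : Ell2 d) : ‖ψ‖ₑ ≤ ∑' x, ‖(ψ : Site d → ℂ) x‖ₑ := by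
  have h := lp.hasSum_single (E := fun _ : Site d => ℂ) (p := 2) (by norm_num) ψ
  calc ‖ψ‖ₑ = ‖∑' x, lp.single 2 x ((ψ : Site d → ℂ) x)‖ₑ := by rw [h.tsum_eq]
    _ ≤ ∑' x, ‖(lp.single 2 x ((ψ : Site d → ℂ) x) : Ell2 d)‖ₑ := enorm_tsum_le_tsum_enorm
    _ = _ := by
      refine tsum_congr fun x => ?_
      rw [← ofReal_norm, ← ofReal_norm, lp.norm_single (by norm_num)]

/-- Expand ψ in the standard basis and bound each |ψ(x)| by the ℓ² norm. The row sum may be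
infinite, so everything is kept in `ℝ≥0∞`. -/
lemma enorm_resolventOp_apply_le {d : ℕ} (V : Site d → ℝ) (K : Site d → Site d → ℂ) (g : ℝ)
    (z : ℂ) (ψ : Ell2 d) (m : Site d) :
    ‖(resolventOp (hamiltonian V K g) z ψ : Site d → ℂ) m‖ₑ ≤
      ‖ψ‖ₑ * ∑' x, ‖green V K g z m x‖ₑ := by
  set R := (lp.evalCLM ℂ (fun _ : Site d => ℂ) 2 m).comp (resolventOp (hamiltonian V K g) z)
  have h := (lp.hasSum_single (E := fun _ : Site d => ℂ) (p := 2) (by norm_num) ψ).mapL R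
  have hterm : ∀ x, R (lp.single 2 x ((ψ : Site d → ℂ) x)) =
      (ψ : Site d → ℂ) x * green V K g z m x := by
    intro x
    have : (lp.single 2 x ((ψ : Site d → ℂ) x) : Ell2 d) =
        (ψ : Site d → ℂ) x • (lp.single 2 x (1 : ℂ) : Ell2 d) := by
      rw [← lp.single_smul, smul_eq_mul, mul_one]
    rw [this, map_smul, smul_eq_mul]
    rfl
  calc ‖(resolventOp (hamiltonian V K g) z ψ : Site d → ℂ) m‖ₑ
      = ‖∑' x, R (lp.single 2 x ((ψ : Site d → ℂ) x))‖ₑ := by rw [h.tsum_eq]; rfl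
    _ ≤ ∑' x, ‖R (lp.single 2 x ((ψ : Site d → ℂ) x))‖ₑ := enorm_tsum_le_tsum_enorm
    _ ≤ ∑' x, ‖ψ‖ₑ * ‖green V K g z m x‖ₑ := by
        refine ENNReal.tsum_le_tsum fun x => ?_
        rw [hterm, enorm_mul]
        gcongr
        rw [← ofReal_norm, ← ofReal_norm]
        exact ENNReal.ofReal_le_ofReal (lp.norm_apply_le_norm (by norm_num) ψ x)
    _ = _ := ENNReal.tsum_mul_left

/-- The right side involves only the energy λ+iε, although ε' ranges over a whole interval.
Countably many energies thus control all ε', and no supremum over ε' enters an expectation. -/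
lemma enorm_green_sub_le {d : ℕ} (V : Site d → ℝ) {K : Site d → Site d → ℂ} {c : ℝ}
    (hK : IsHopping K c) (g lam : ℝ) {ε ε' : ℝ} (hε : 0 < ε) (h1 : ε / 2 ≤ ε') (h2 : ε' ≤ ε)
    (m n : Site d) :
    ‖green V K g (lam + ε' * Complex.I) m n - green V K g (lam + ε * Complex.I) m n‖ₑ ≤
      ENNReal.ofReal (2 * ε) * ((∑' x, ‖green V K g (lam + ε * Complex.I) m x‖ₑ) *
        ∑' x, ‖green V K g (lam + ε * Complex.I) x n‖ₑ) := by
  have hε' : 0 < ε' := by linarith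
  set z : ℂ := lam + ε * Complex.I with hz
  set w : ℂ := lam + ε' * Complex.I with hw
  have hzi : z.im = ε := by simp [hz]
  have hwi : w.im = ε' := by simp [hw]
  have hz0 : z.im ≠ 0 := by rw [hzi]; exact hε.ne'
  have hw0 : w.im ≠ 0 := by rw [hwi]; exact hε'.ne'
  have hzw : ‖z - w‖ ≤ ε' := by
    have : z - w = ((ε - ε' : ℝ) : ℂ) * Complex.I := by rw [hz, hw]; push_cast; ring
    rw [this, norm_mul, Complex.norm_I, mul_one, Complex.norm_real, Real.norm_eq_abs,
      abs_of_nonneg (by linarith)]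
    linarith
  set δ : Ell2 d := lp.single 2 n (1 : ℂ)
  set ψ := resolventOp (hamiltonian V K g) w δ with hψ
  -- Here ε' ≥ ε/2 enters: |z-w| = ε - ε' ≤ ε' = Im w, so |z-w| times the norm of the resolvent at w
  -- is at most 1.
  have hnorm : ‖ψ‖ ≤ 2 * ‖resolventOp (hamiltonian V K g) z δ‖ := by
    have e := resolventOp_eq_resolventOp_add V hK g hz0 hw0 δ
    rw [map_add, ← sub_eq_iff_eq_add] at e
    rw [hψ, ← e]
    refine (norm_sub_le _ _).trans ?_
    have e1 := norm_resolventOp_apply_le V hK g hw0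
      ((z - w) • resolventOp (hamiltonian V K g) z δ)
    rw [norm_smul, hwi, abs_of_pos hε', ← mul_assoc] at e1
    have e2 : ε'⁻¹ * ‖z - w‖ ≤ 1 := by rw [inv_mul_le_iff₀ hε']; linarith
    have e3 := mul_le_mul_of_nonneg_right e2 (norm_nonneg (resolventOp (hamiltonian V K g) z δ))
    linarith
  have hcol : ‖ψ‖ₑ ≤ 2 * ∑' x, ‖green V K g z x n‖ₑ := by
    calc ‖ψ‖ₑ ≤ 2 * ‖resolventOp (hamiltonian V K g) z δ‖ₑ := by
          rw [← ofReal_norm, ← ofReal_norm]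
          refine (ENNReal.ofReal_le_ofReal hnorm).trans_eq ?_
          rw [ENNReal.ofReal_mul two_pos.le, ENNReal.ofReal_ofNat]
      _ ≤ _ := by gcongr; exact enorm_le_tsum_enorm _
  have hdiff : green V K g w m n - green V K g z m n =
      (w - z) * (resolventOp (hamiltonian V K g) z ψ : Site d → ℂ) m := by
    have e := resolventOp_eq_resolventOp_add V hK g hw0 hz0 δ
    rw [map_add, map_smul] at e
    have e' := congrFun (congrArg (fun ψ : Ell2 d => (ψ : Site d → ℂ)) e) m
    simp only [lp.coeFn_add, lp.coeFn_smul, Pi.add_apply, Pi.smul_apply, smul_eq_mul] at e'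
    exact sub_eq_of_eq_add' e'
  rw [hdiff, enorm_mul]
  calc _ ≤ ENNReal.ofReal ε * ((2 * ∑' x, ‖green V K g z x n‖ₑ) *
        ∑' x, ‖green V K g z m x‖ₑ) := by
        refine mul_le_mul' ?_ ((enorm_resolventOp_apply_le V K g z ψ m).trans (by gcongr))
        rw [← ofReal_norm, norm_sub_rev]
        exact ENNReal.ofReal_le_ofReal (hzw.trans h2)
    _ = _ := by
        rw [ENNReal.ofReal_mul two_pos.le, ENNReal.ofReal_ofNat]
        ring

/-- A function whose oscillation on dyadic intervals is summable has a limit at `0+`. -/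
lemma exists_tendsto_of_dyadic {E : Type*} [PseudoEMetricSpace E] [CompleteSpace E] {f : ℝ → E}
    {δ : ℕ → ℝ≥0∞} (hδ : ∑' j, δ j ≠ ∞)
    (h : ∀ j : ℕ, ∀ t, (1 / 2 : ℝ) ^ (j + 1) ≤ t → t ≤ (1 / 2 : ℝ) ^ j →
      edist (f t) (f ((1 / 2 : ℝ) ^ j)) ≤ δ j) :
    ∃ l, Tendsto f (𝓝[>] 0) (𝓝 l) := by
  have hmono : ∀ j : ℕ, (1 / 2 : ℝ) ^ (j + 1) ≤ (1 / 2 : ℝ) ^ j := fun j =>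
    pow_le_pow_of_le_one (by norm_num) (by norm_num) (Nat.le_succ j)
  have hc : CauchySeq fun j : ℕ => f ((1 / 2 : ℝ) ^ j) :=
    cauchySeq_of_edist_le_of_tsum_ne_top δ (fun j => by
      rw [edist_comm]; exact h j _ le_rfl (hmono j)) hδ
  obtain ⟨l, hl⟩ := cauchySeq_tendsto_of_complete hc
  refine ⟨l, EMetric.tendsto_nhds.2 fun ε hε => ?_⟩
  have hε2 : 0 < ε / 2 := ENNReal.half_pos hε.ne'
  have h1 := (EMetric.tendsto_nhds.1 hl (ε / 2) hε2).and
    ((ENNReal.tendsto_atTop_zero_of_tsum_ne_top hδ).eventually_lt_const hε2)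
  obtain ⟨J, hJ⟩ := eventually_atTop.1 h1
  filter_upwards [Ioo_mem_nhdsGT (show (0 : ℝ) < (1 / 2) ^ J by positivity)] with t ht
  obtain ⟨j, hj1, hj2⟩ := exists_nat_pow_near_of_lt_one ht.1
    (ht.2.le.trans (pow_le_one₀ (by norm_num) (by norm_num))) (show (0 : ℝ) < 1 / 2 by norm_num)
    (by norm_num)
  have hjJ : J ≤ j := by
    by_contra! hlt
    have : (1 / 2 : ℝ) ^ J ≤ (1 / 2) ^ (j + 1) :=
      pow_le_pow_of_le_one (by norm_num) (by norm_num) hlt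
    linarith [ht.2]
  calc edist (f t) l ≤ edist (f t) (f ((1 / 2 : ℝ) ^ j)) + edist (f ((1 / 2 : ℝ) ^ j)) l :=
        edist_triangle _ _ _
    _ < ε / 2 + ε / 2 :=
        ENNReal.add_lt_add ((h j t hj1.le hj2).trans_lt (hJ j hjJ).2) (hJ j hjJ).1
    _ = ε := ENNReal.add_halves ε

/-! ### Fractional powers of sums and products. -/

lemma tsum_rpow_le {ι : Type*} (f : ι → ℝ≥0∞) {s : ℝ} (hs : 0 < s) (hs1 : s ≤ 1) :
    (∑' i, f i) ^ s ≤ ∑' i, f i ^ s := by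
  have hfin : ∀ T : Finset ι, (∑ i ∈ T, f i) ^ s ≤ ∑ i ∈ T, f i ^ s := by
    classical
    intro T
    induction T using Finset.induction_on with
    | empty => simp [hs]
    | insert x T hx ih =>
      rw [Finset.sum_insert hx, Finset.sum_insert hx]
      exact (ENNReal.rpow_add_le_add_rpow _ _ hs.le hs1).trans (add_le_add_right ih _)
  rw [← ENNReal.le_rpow_inv_iff hs, ENNReal.tsum_eq_iSup_sum]
  refine iSup_le fun T => ?_
  rw [ENNReal.le_rpow_inv_iff hs]
  exact (hfin T).trans (ENNReal.sum_le_tsum T)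

/-- Row and column sums are not independent; halving the exponent lets their product be handled by
the s-th moments of each. -/
lemma mul_rpow_half_le (x y : ℝ≥0∞) {s : ℝ} (hs : 0 < s) :
    (x * y) ^ (s / 2) ≤ x ^ s + y ^ s := by
  have key : ∀ x y : ℝ≥0∞, x ≤ y → (x * y) ^ (s / 2) ≤ y ^ s := by
    intro x y hxy
    calc (x * y) ^ (s / 2) ≤ (y * y) ^ (s / 2) := by gcongr
      _ = y ^ s := by
        rw [← pow_two, ← ENNReal.rpow_natCast, ← ENNReal.rpow_mul]
        congr 1
        push_cast
        ring
  rcases le_total x y with h | h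
  · exact (key x y h).trans le_add_self
  · rw [mul_comm]
    exact (key y x h).trans le_self_add

/-! ### Summability of exponentials on the lattice -/

lemma summable_pow_natAbs_sub (b : ℤ) :
    Summable fun j : ℤ => (1 / 2 : ℝ) ^ (j - b).natAbs := by
  have h : Summable fun j : ℤ => (1 / 2 : ℝ) ^ j.natAbs :=
    Summable.of_nat_of_neg (f := fun j : ℤ => (1 / 2 : ℝ) ^ j.natAbs)
      (by simpa only [Int.natAbs_natCast] using summable_geometric_two)
      (by simpa only [Int.natAbs_neg, Int.natAbs_natCast] using summable_geometric_two)
  exact h.comp_injective (i := fun j : ℤ => j - b) (sub_left_injective)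

/-- Any finite set of sites lies in a box, over which the sum factorizes into one-dimensional
geometric sums. -/
lemma summable_pow_latticeDist {d : ℕ} (n : Site d) :
    Summable fun x : Site d => (1 / 2 : ℝ) ^ latticeDist x n := by
  classical
  refine summable_of_sum_le (c := ∏ i, ∑' j : ℤ, (1 / 2 : ℝ) ^ (j - n i).natAbs)
    (fun x => by positivity) fun T => ?_
  have hsub : T ⊆ Fintype.piFinset fun i => T.image fun x => x i := fun x hx =>
    Fintype.mem_piFinset.2 fun i => Finset.mem_image_of_mem (fun x : Site d => x i) hx
  calc ∑ x ∈ T, (1 / 2 : ℝ) ^ latticeDist x n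
      ≤ ∑ x ∈ Fintype.piFinset fun i => T.image fun x => x i, (1 / 2 : ℝ) ^ latticeDist x n :=
        Finset.sum_le_sum_of_subset_of_nonneg hsub fun _ _ _ => by positivity
    _ = ∑ x ∈ Fintype.piFinset fun i => T.image fun x => x i,
          ∏ i, (1 / 2 : ℝ) ^ (x i - n i).natAbs := by
        simp only [latticeDist, Finset.prod_pow_eq_pow_sum]
    _ = ∏ i, ∑ j ∈ T.image fun x => x i, (1 / 2 : ℝ) ^ (j - n i).natAbs :=
        (Finset.prod_univ_sum (fun i => T.image fun x => x i)
          fun i j => (1 / 2 : ℝ) ^ (j - n i).natAbs).symm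
    _ ≤ _ := Finset.prod_le_prod (fun i _ => Finset.sum_nonneg fun _ _ => by positivity)
        fun i _ => (summable_pow_natAbs_sub (n i)).sum_le_tsum _ fun _ _ => by positivity

lemma tsum_ofReal_pow_latticeDist_ne_top {d : ℕ} (n : Site d) {b τ : ℝ} (hb : 0 ≤ b) (hτ : 0 ≤ τ)
    (hτ2 : τ ≤ 1 / 2) : ∑' x : Site d, ENNReal.ofReal (b * τ ^ latticeDist x n) ≠ ∞ := by
  have hs : Summable fun x : Site d => b * τ ^ latticeDist x n :=
    Summable.of_nonneg_of_le (fun x => by positivity) (fun x => by gcongr)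
      ((summable_pow_latticeDist n).mul_left b)
  rw [← ENNReal.ofReal_tsum_of_nonneg (fun x => by positivity) hs]
  exact ENNReal.ofReal_ne_top

/-! ### Convergence of moments -/

/-- Almost-everywhere convergence and a bound on a higher moment give convergence of integrals. -/
lemma tendsto_lintegral_of_rpow_bound {Ω ι : Type*} {mΩ : MeasurableSpace Ω} {P : Measure Ω}
    [IsFiniteMeasure P] {l : Filter ι} [l.IsCountablyGenerated] {f : ι → Ω → ℝ≥0∞}
    {f₀ : Ω → ℝ≥0∞} {p : ℝ} (hp : 1 < p) {M : ℝ≥0∞} (hM : M ≠ ∞)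
    (hf : ∀ᶠ i in l, Measurable (f i)) (hf₀ : AEMeasurable f₀ P)
    (hbound : ∀ᶠ i in l, ∫⁻ ω, f i ω ^ p ∂P ≤ M)
    (hlim : ∀ᵐ ω ∂P, Tendsto (fun i => f i ω) l (𝓝 (f₀ ω))) :
    Tendsto (fun i => ∫⁻ ω, f i ω ∂P) l (𝓝 (∫⁻ ω, f₀ ω ∂P)) := by
  -- Truncation at height N reduces to dominated convergence. The lower bound then follows by
  -- monotone convergence in N, the upper one from the p-th moment.
  have htrunc : ∀ N : ℕ, Tendsto (fun i => ∫⁻ ω, min (f i ω) N ∂P) l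
      (𝓝 (∫⁻ ω, min (f₀ ω) N ∂P)) := by
    intro N
    refine tendsto_lintegral_filter_of_dominated_convergence (fun _ => (N : ℝ≥0∞)) ?_ ?_ ?_ ?_
    · filter_upwards [hf] with i hi using hi.min measurable_const
    · exact Eventually.of_forall fun i => Eventually.of_forall fun ω => min_le_right _ _
    · rw [lintegral_const]
      exact ENNReal.mul_ne_top (ENNReal.natCast_ne_top N) (measure_ne_top P _)
    · filter_upwards [hlim] with ω hω using hω.min tendsto_const_nhds
  refine tendsto_order.2 ⟨fun b hb => ?_, fun b hb => ?_⟩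
  · have hmono : Tendsto (fun N : ℕ => ∫⁻ ω, min (f₀ ω) N ∂P) atTop (𝓝 (∫⁻ ω, f₀ ω ∂P)) := by
      refine lintegral_tendsto_of_tendsto_of_monotone
        (fun N => hf₀.min aemeasurable_const) (Eventually.of_forall fun ω N N' h => ?_)
        (Eventually.of_forall fun ω => ?_)
      · exact min_le_min_left _ (by exact_mod_cast h)
      · have := (tendsto_const_nhds (x := f₀ ω)).min ENNReal.tendsto_nat_nhds_top
        simpa using this
    obtain ⟨N, hN⟩ := (hmono.eventually_const_lt hb).exists
    filter_upwards [(htrunc N).eventually_const_lt hN] with i hi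
    exact hi.trans_le (lintegral_mono fun ω => min_le_left _ _)
  · have hsmall : Tendsto (fun N : ℕ => ∫⁻ ω, f₀ ω ∂P + ((N : ℝ≥0∞) ^ (p - 1))⁻¹ * M) atTop
        (𝓝 (∫⁻ ω, f₀ ω ∂P + 0 * M)) := by
      refine tendsto_const_nhds.add (ENNReal.Tendsto.mul_const ?_ (Or.inr hM))
      have h1 : Tendsto (fun N : ℕ => ((N : ℝ≥0∞) ^ (p - 1))) atTop (𝓝 ∞) := by
        have := (ENNReal.continuous_rpow_const (y := p - 1)).tendsto ∞ |>.comp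
          ENNReal.tendsto_nat_nhds_top
        rwa [ENNReal.top_rpow_of_pos (by linarith)] at this
      simpa using h1.inv
    rw [zero_mul, add_zero] at hsmall
    obtain ⟨N, hN, hN1⟩ := ((hsmall.eventually_lt_const hb).and (eventually_ge_atTop 1)).exists
    have hN0 : (N : ℝ≥0∞) ≠ 0 := by exact_mod_cast (by omega : N ≠ 0)
    -- Above height N one has x ≤ N^(1-p) x^p, so the truncated part is at most N^(1-p) M, uniformly
    -- along the filter.
    have hpt : ∀ x : ℝ≥0∞, x ≤ min x N + ((N : ℝ≥0∞) ^ (p - 1))⁻¹ * x ^ p := by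
      intro x
      rcases le_total x N with h | h
      · rw [min_eq_left h]; exact le_self_add
      · refine le_add_left ?_
        have hNp0 : (N : ℝ≥0∞) ^ (p - 1) ≠ 0 := by
          simpa [ENNReal.rpow_eq_zero_iff] using fun h0 => absurd h0 (by exact_mod_cast hN0)
        have hNpt : (N : ℝ≥0∞) ^ (p - 1) ≠ ∞ :=
          ENNReal.rpow_ne_top_of_nonneg (by linarith) (ENNReal.natCast_ne_top N)
        rw [← ENNReal.div_eq_inv_mul, ENNReal.le_div_iff_mul_le (Or.inl hNp0) (Or.inl hNpt)]
        calc x * (N : ℝ≥0∞) ^ (p - 1) ≤ x ^ (1 : ℝ) * x ^ (p - 1) := by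
              rw [ENNReal.rpow_one]; gcongr
          _ = x ^ p := by
              rw [← ENNReal.rpow_add_of_nonneg _ _ zero_le_one (by linarith)]
              congr 1
              ring
    have hlim' : Tendsto (fun i => ∫⁻ ω, min (f i ω) N ∂P + ((N : ℝ≥0∞) ^ (p - 1))⁻¹ * M) l
        (𝓝 (∫⁻ ω, min (f₀ ω) N ∂P + ((N : ℝ≥0∞) ^ (p - 1))⁻¹ * M)) :=
      (htrunc N).add tendsto_const_nhds
    have hlt : ∫⁻ ω, min (f₀ ω) N ∂P + ((N : ℝ≥0∞) ^ (p - 1))⁻¹ * M < b :=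
      lt_of_le_of_lt (by gcongr; exact min_le_left _ _) hN
    filter_upwards [hlim'.eventually_lt_const hlt, hf, hbound] with i hi hfi hbi
    refine lt_of_le_of_lt ?_ hi
    calc ∫⁻ ω, f i ω ∂P
        ≤ ∫⁻ ω, (min (f i ω) N + ((N : ℝ≥0∞) ^ (p - 1))⁻¹ * f i ω ^ p) ∂P :=
          lintegral_mono fun ω => hpt _
      _ = ∫⁻ ω, min (f i ω) N ∂P + ((N : ℝ≥0∞) ^ (p - 1))⁻¹ * ∫⁻ ω, f i ω ^ p ∂P := by
          rw [lintegral_add_left (hfi.min measurable_const), lintegral_const_mul _ (by fun_prop)]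
      _ ≤ _ := by gcongr

/-! ### Boundary values of the Green function -/

section boundary

variable {d : ℕ} {Ω : Type*} {mΩ : MeasurableSpace Ω} {α q cA1 cA2 cK ca : ℝ} {k : ℕ}
  {Γ : AddSubgroup (Site d)} {a : Site d → ℝ} {K : Site d → Site d → ℂ} {P : Measure Ω}
  {v : Γ → Ω → ℝ} {μ : Measure ℝ}

lemma enorm_rpow_eq_ofReal (z : ℂ) {s : ℝ} (hs : 0 ≤ s) :
    ‖z‖ₑ ^ s = ENNReal.ofReal (‖z‖ ^ s) := by
  rw [← ofReal_norm, ENNReal.ofReal_rpow_of_nonneg (norm_nonneg _) hs]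

/-- Fractional moments of a sum over the lattice. -/
lemma lintegral_tsum_enorm_rpow_le {f : Site d → Ω → ℂ} (hf : ∀ x, Measurable (f x)) {s : ℝ}
    (hs : 0 < s) (hs1 : s ≤ 1) {b : Site d → ℝ≥0∞}
    (hb : ∀ x, ∫⁻ ω, ENNReal.ofReal (‖f x ω‖ ^ s) ∂P ≤ b x) :
    ∫⁻ ω, (∑' x, ‖f x ω‖ₑ) ^ s ∂P ≤ ∑' x, b x := by
  calc ∫⁻ ω, (∑' x, ‖f x ω‖ₑ) ^ s ∂P ≤ ∫⁻ ω, ∑' x, ‖f x ω‖ₑ ^ s ∂P :=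
        lintegral_mono fun ω => tsum_rpow_le _ hs hs1
    _ = ∑' x, ∫⁻ ω, ‖f x ω‖ₑ ^ s ∂P :=
        lintegral_tsum fun x => by have := hf x; fun_prop
    _ ≤ _ := ENNReal.tsum_le_tsum fun x => by
        simpa only [enorm_rpow_eq_ofReal _ hs.le] using hb x

/-- Exponential decay of fractional moments, uniform in the distance to the real axis, implies the
existence of boundary values. -/
lemma IsAlloySetup.ae_exists_tendsto_green (h : IsAlloySetup α q cA1 cA2 cK ca k Γ a K P v μ)
    {s : ℝ} (hs : 0 < s) (hs1 : s ≤ 1) {B τ lam g : ℝ} (hB : 0 ≤ B) (hτ : 0 ≤ τ) (hτ2 : τ ≤ 1 / 2)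
    (hbound : ∀ z : ℂ, z.re = lam → z.im ≠ 0 → ∀ m n : Site d,
      ∫⁻ ω, ENNReal.ofReal (‖green (alloyPotential Γ a fun y => v y ω) K g z m n‖ ^ s) ∂P ≤
        ENNReal.ofReal (B * τ ^ latticeDist m n)) (m n : Site d) :
    ∀ᵐ ω ∂P, ∃ l, Tendsto (fun ε : ℝ => green (alloyPotential Γ a fun y => v y ω) K g
      (lam + ε * Complex.I) m n) (𝓝[>] 0) (𝓝 l) := by
  set G : ℝ → Site d → Site d → Ω → ℂ := fun ε m n ω =>
    green (alloyPotential Γ a fun y => v y ω) K g (lam + ε * Complex.I) m n with hG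
  have hre : ∀ ε : ℝ, ((lam : ℂ) + ε * Complex.I).re = lam := fun ε => by simp
  have him : ∀ ε : ℝ, 0 < ε → ((lam : ℂ) + ε * Complex.I).im ≠ 0 := fun ε hε => by
    simpa using hε.ne'
  have hGm : ∀ ε : ℝ, 0 < ε → ∀ m n, Measurable (G ε m n) := fun ε hε m n =>
    h.measurable_green g (him ε hε) m n
  set e : ℕ → ℝ := fun j => (1 / 2 : ℝ) ^ j with he
  have he0 : ∀ j, 0 < e j := fun j => by positivity
  set row : ℕ → Ω → ℝ≥0∞ := fun j ω => ∑' x, ‖G (e j) m x ω‖ₑ with hrow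
  set col : ℕ → Ω → ℝ≥0∞ := fun j ω => ∑' x, ‖G (e j) x n ω‖ₑ with hcol
  have hrowm : ∀ j, Measurable (row j) := fun j =>
    Measurable.tsum fun x => (hGm _ (he0 j) m x).enorm
  have hcolm : ∀ j, Measurable (col j) := fun j =>
    Measurable.tsum fun x => (hGm _ (he0 j) x n).enorm
  set Mr := ∑' x : Site d, ENNReal.ofReal (B * τ ^ latticeDist x m) with hMr
  set Mc := ∑' x : Site d, ENNReal.ofReal (B * τ ^ latticeDist x n) with hMc
  have hMrt : Mr ≠ ∞ := tsum_ofReal_pow_latticeDist_ne_top m hB hτ hτ2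
  have hMct : Mc ≠ ∞ := tsum_ofReal_pow_latticeDist_ne_top n hB hτ hτ2
  have hrowI : ∀ j, ∫⁻ ω, row j ω ^ s ∂P ≤ Mr := fun j =>
    lintegral_tsum_enorm_rpow_le (fun x => hGm _ (he0 j) m x) hs hs1 fun x => by
      rw [latticeDist_comm x m]
      exact hbound _ (hre _) (him _ (he0 j)) m x
  have hcolI : ∀ j, ∫⁻ ω, col j ω ^ s ∂P ≤ Mc := fun j =>
    lintegral_tsum_enorm_rpow_le (fun x => hGm _ (he0 j) x n) hs hs1 fun x =>
      hbound _ (hre _) (him _ (he0 j)) x n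
  set δ : ℕ → Ω → ℝ≥0∞ := fun j ω => ENNReal.ofReal (2 * e j) * (row j ω * col j ω) with hδ
  have hδm : ∀ j, Measurable (δ j) := fun j => ((hrowm j).mul (hcolm j)).const_mul _
  -- The factor ε_j = 2^(-j) from the resolvent identity makes these moments summable in j, while Mr
  -- and Mc do not depend on j.
  have hδI : ∀ j, ∫⁻ ω, δ j ω ^ (s / 2) ∂P ≤
      ENNReal.ofReal ((2 * e j) ^ (s / 2)) * (Mr + Mc) := by
    intro j
    calc ∫⁻ ω, δ j ω ^ (s / 2) ∂P
        ≤ ∫⁻ ω, ENNReal.ofReal ((2 * e j) ^ (s / 2)) * (row j ω ^ s + col j ω ^ s) ∂P := by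
          refine lintegral_mono fun ω => ?_
          simp only [hδ]
          rw [ENNReal.mul_rpow_of_nonneg _ _ (by positivity),
            ENNReal.ofReal_rpow_of_nonneg (by positivity) (by positivity)]
          gcongr
          exact mul_rpow_half_le _ _ hs
      _ = ENNReal.ofReal ((2 * e j) ^ (s / 2)) *
          (∫⁻ ω, row j ω ^ s ∂P + ∫⁻ ω, col j ω ^ s ∂P) := by
          rw [lintegral_const_mul' _ _ ENNReal.ofReal_ne_top,
            lintegral_add_left ((hrowm j).pow_const s)]
      _ ≤ _ := by gcongr <;> [exact hrowI j; exact hcolI j]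
  have hsum : Summable fun j => (2 * e j) ^ (s / 2) := by
    have hgeo : ∀ j, (2 * e j) ^ (s / 2) = 2 ^ (s / 2) * ((1 / 2 : ℝ) ^ (s / 2)) ^ j := by
      intro j
      rw [Real.mul_rpow two_pos.le (he0 j).le]
      congr 1
      simp only [he]
      rw [← Real.rpow_natCast, ← Real.rpow_natCast, ← Real.rpow_mul (by norm_num),
        ← Real.rpow_mul (by norm_num), mul_comm]
    simp only [hgeo]
    exact (summable_geometric_of_lt_one (by positivity)
      (Real.rpow_lt_one (by norm_num) (by norm_num) (by positivity))).mul_left _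
  have htot : ∫⁻ ω, ∑' j, δ j ω ^ (s / 2) ∂P ≠ ∞ := by
    rw [lintegral_tsum fun j => ((hδm j).pow_const _).aemeasurable]
    refine ((ENNReal.tsum_le_tsum hδI).trans_lt ?_).ne
    rw [ENNReal.tsum_mul_right, ← ENNReal.ofReal_tsum_of_nonneg (fun j => by positivity) hsum]
    exact ENNReal.mul_lt_top ENNReal.ofReal_lt_top
      (ENNReal.add_lt_top.2 ⟨hMrt.lt_top, hMct.lt_top⟩)
  filter_upwards [ae_lt_top (Measurable.tsum fun j => (hδm j).pow_const _) htot] with ω hω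
  -- Since s/2 ≤ 1, finiteness of the sum of the powers forces finiteness of the sum itself.
  have hδω : ∑' j, δ j ω ≠ ∞ := by
    intro htop
    have h1 := tsum_rpow_le (fun j => δ j ω) (s := s / 2) (by positivity) (by linarith)
    rw [htop, ENNReal.top_rpow_of_pos (by positivity)] at h1
    exact (h1.trans_lt hω).ne rfl
  refine exists_tendsto_of_dyadic hδω fun j t ht1 ht2 => ?_
  rw [edist_eq_enorm_sub]
  exact enorm_green_sub_le _ h.hopping g lam (he0 j)
    (by simp only [he]; rw [pow_succ] at ht1; linarith) ht2 m n

end boundary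

end AlloyModel

/-! ### The main theorem. -/

theorem theorem4 (α q s cA1 cA2 cK ca : ℝ) (k : ℕ) (hα : 0 < α) (hq : 0 < q) (hs : 0 < s)
    (hs' : s < α * q / (2 * (k : ℝ) * α + (k : ℝ) * q)) :
    ∃ C : ℝ, 0 < C ∧
      ∀ (d : ℕ) (_ : 0 < d)
        -- the sublattice, the single-site coefficients, and the covering condition
        (Γ : AddSubgroup (AlloyModel.Site d)) (a : AlloyModel.Site d → ℝ)
        (_ : (Function.support a).Finite) (_ : (Function.support a).ncard = k)
        (_ : ∀ x, a x ≠ 0 → |a x| ≤ ca ∧ |a x|⁻¹ ≤ ca)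
        (_ : ∀ n : AlloyModel.Site d, ∃ m ∈ Γ, a (n - m) ≠ 0)
        -- the hopping kernel
        (K : AlloyModel.Site d → AlloyModel.Site d → ℂ) (_ : AlloyModel.IsHopping K cK)
        -- the independent, identically distributed random variables
        (Ω : Type*) (_ : MeasurableSpace Ω) (P : Measure Ω) (_ : IsProbabilityMeasure P)
        (v : Γ → Ω → ℝ) (_ : ∀ m, Measurable (v m)) (_ : iIndepFun v P)
        (μ : Measure ℝ) (_ : ∀ m, P.map (v m) = μ)
        (_ : AlloyModel.IsRegularMeasure μ α cA1) (_ : AlloyModel.HasMomentBound μ q cA2)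
        -- energy and coupling
        (lam g : ℝ) (_ : C * (d : ℝ) ^ (1 / s) / (1 + |lam|) ≤ g)
        (m n : AlloyModel.Site d),
        let G : ℝ → Ω → ℂ := fun ε ω =>
          AlloyModel.green (AlloyModel.alloyPotential Γ a (fun x => v x ω)) K g
            ((lam : ℂ) + (ε : ℂ) * Complex.I) m n
        ∃ G₀ : Ω → ℂ, AEMeasurable G₀ P ∧
          (∀ᵐ ω ∂P, Tendsto (fun ε => G ε ω) (𝓝[>] 0) (𝓝 (G₀ ω))) ∧
          Tendsto (fun ε => ∫⁻ ω, ENNReal.ofReal (‖G ε ω‖ ^ s) ∂P) (𝓝[>] 0)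
            (𝓝 (∫⁻ ω, ENNReal.ofReal (‖G₀ ω‖ ^ s) ∂P)) ∧
          ∫⁻ ω, ENNReal.ofReal (‖G₀ ω‖ ^ s) ∂P ≤ ENNReal.ofReal
            (C / (1 + |lam|) ^ s *
              (C * (d : ℝ) / (g ^ s * (1 + |lam|) ^ s)) ^ AlloyModel.latticeDist m n) := by
  classical
  set s₀ := α * q / (2 * (k : ℝ) * α + (k : ℝ) * q) with hs₀
  -- A second admissible exponent above s: its moment bound supplies the uniform integrability
  -- needed to pass to the limit at s.
  set s' := (s + s₀) / 2 with hs'def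
  have hss' : s < s' := by rw [hs'def]; linarith
  have hs's₀ : s' < s₀ := by rw [hs'def]; linarith
  have hs'0 : 0 < s' := hs.trans hss'
  obtain ⟨C₁, hC₁, hb₁⟩ :=
    AlloyModel.exists_uniform_lintegral_green_le cA1 cA2 cK ca hα hq hs hs'
  obtain ⟨C₂, hC₂, hb₂⟩ :=
    AlloyModel.exists_uniform_lintegral_green_le cA1 cA2 cK ca hα hq hs'0 hs's₀
  refine ⟨max C₁ C₂, lt_max_of_lt_left hC₁, ?_⟩
  intro d hd Γ a hfin hcard hbd hcov K hK Ω mΩ P hP v hv hind μ hlaw hreg hmom lam g hg m n G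
  have hsetup : AlloyModel.IsAlloySetup α q cA1 cA2 cK ca k Γ a K P v μ :=
    ⟨hP, hfin, hcard, hbd, hcov, hK, hv, hind, hlaw, hreg, hmom⟩
  have hd1 : (1 : ℝ) ≤ d := by exact_mod_cast hd
  have hlam : 0 < 1 + |lam| := by positivity
  have hg1 : C₁ * (d : ℝ) ^ (1 / s) / (1 + |lam|) ≤ g :=
    le_trans (by gcongr; exact le_max_left _ _) hg
  have hgpos : 0 < g := lt_of_lt_of_le (by positivity) hg1
  -- One coupling condition serves both exponents, because d ≥ 1 and s < s' give d^(1/s') ≤ d^(1/s).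
  have hg2 : C₂ * (d : ℝ) ^ (1 / s') / (1 + |lam|) ≤ g := by
    refine le_trans ?_ hg
    gcongr
    · exact le_max_right _ _
  obtain ⟨τ, hτ0, hτ2, hτ, hbound⟩ := hb₁ hd hsetup hg1
  obtain ⟨τ', -, -, -, hbound'⟩ := hb₂ hd hsetup hg2
  have hre : ∀ ε : ℝ, ((lam : ℂ) + ε * Complex.I).re = lam := fun ε => by simp
  have him : ∀ ε : ℝ, 0 < ε → ((lam : ℂ) + ε * Complex.I).im ≠ 0 := fun ε hε => by
    simpa using hε.ne'
  have hGm : ∀ ε : ℝ, 0 < ε → Measurable (G ε) := fun ε hε =>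
    hsetup.measurable_green g (him ε hε) m n
  have hs1 : s ≤ 1 := by
    have := hsetup.isProbabilityMeasure
    exact AlloyModel.le_one_of_lt_exponent hα hq hs hreg.le_one hs'
  have hae := hsetup.ae_exists_tendsto_green hs hs1 (by positivity) hτ0 hτ2 hbound m n
  set G₀ : Ω → ℂ := fun ω => if h : ∃ l, Tendsto (fun ε => G ε ω) (𝓝[>] 0) (𝓝 l)
    then h.choose else 0 with hG₀
  have hlim : ∀ᵐ ω ∂P, Tendsto (fun ε => G ε ω) (𝓝[>] 0) (𝓝 (G₀ ω)) := by
    filter_upwards [hae] with ω hω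
    simp only [hG₀]
    rw [dif_pos hω]
    exact hω.choose_spec
  -- The pointwise choice of limits carries no measurability; it is recovered almost everywhere as a
  -- limit along the sequence 1/(j+1).
  have hG₀m : AEMeasurable G₀ P := by
    have hseq : Tendsto (fun j : ℕ => 1 / ((j : ℝ) + 1)) atTop (𝓝[>] 0) :=
      tendsto_nhdsWithin_iff.2 ⟨tendsto_one_div_add_atTop_nhds_zero_nat,
        Eventually.of_forall fun j => by simp only [Set.mem_Ioi]; positivity⟩
    refine aemeasurable_of_tendsto_metrizable_ae atTop
      (f := fun (j : ℕ) => G (1 / ((j : ℝ) + 1)))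
      (fun j => (hGm _ (by positivity)).aemeasurable) ?_
    filter_upwards [hlim] with ω hω using hω.comp hseq
  have hmoments : Tendsto (fun ε => ∫⁻ ω, ENNReal.ofReal (‖G ε ω‖ ^ s) ∂P) (𝓝[>] 0)
      (𝓝 (∫⁻ ω, ENNReal.ofReal (‖G₀ ω‖ ^ s) ∂P)) := by
    refine AlloyModel.tendsto_lintegral_of_rpow_bound (p := s' / s)
      (M := ENNReal.ofReal (C₂ / (1 + |lam|) ^ s' * τ' ^ AlloyModel.latticeDist m n))
      ((one_lt_div hs).2 hss') ENNReal.ofReal_ne_top ?_ (by fun_prop) ?_ ?_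
    · filter_upwards [self_mem_nhdsWithin] with ε hε
      have := hGm ε hε
      fun_prop
    · filter_upwards [self_mem_nhdsWithin] with ε hε
      refine le_of_eq_of_le (lintegral_congr fun ω => ?_)
        (hbound' _ (hre ε) (him ε hε) m n)
      rw [ENNReal.ofReal_rpow_of_nonneg (by positivity) (by positivity),
        ← Real.rpow_mul (norm_nonneg _), mul_div_cancel₀ _ hs.ne']
    · filter_upwards [hlim] with ω hω
      exact ENNReal.tendsto_ofReal (hω.norm.rpow_const (Or.inr hs.le))
  refine ⟨G₀, hG₀m, hlim, hmoments, le_of_tendsto hmoments ?_⟩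
  filter_upwards [self_mem_nhdsWithin] with ε hε
  refine (hbound _ (hre ε) (him ε hε) m n).trans (ENNReal.ofReal_le_ofReal ?_)
  have hτ' : τ ≤ max C₁ C₂ * d / (g ^ s * (1 + |lam|) ^ s) :=
    hτ.trans (by gcongr; exact le_max_left _ _)
  gcongr
  exact le_max_left _ _
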